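/- Let $X$ be a nonsingular projective variety over $\mathbb{C}$, let $L$ be a line bundle on $X$ and let $E$ be a vector bundle on $X$. Suppose that there is an integer $s_0$ such that for every integer $s \ge s_0$ the vector bundle $E^{\otimes s}\otimes L$ is generated by its global sections. Then $E$ is nef; that is, the line bundle $\mathcal{O}_{\mathbb{P}(E)}(1)$ on the projective bundle $\mathbb{P}(E)$ of one-dimensional quotients of $E$ has nonnegative degree on every integral complete curve $C\subseteq \mathbb{P}(E)$. -/

import Mathlib

open CategoryTheory AlgebraicGeometry TopologicalSpace

noncomputable section

namespace NefBundle

/-! ### Vector bundles and their operations -/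

/-- An `𝒪_X`-module is a vector bundle if every point has an open neighbourhood on which it is
isomorphic to a free module of finite rank. -/
def IsVectorBundle {X : Scheme.{0}} (E : X.Modules) : Prop :=
  ∀ x : X, ∃ U : X.Opens, x ∈ U ∧ ∃ r : ℕ,
    Nonempty (E.restrict U.ι ≅ (SheafOfModules.free (Fin r) : U.toScheme.Modules))

/-- A line bundle is an `𝒪_X`-module that is locally free of rank one. -/
def IsLineBundle {X : Scheme.{0}} (L : X.Modules) : Prop :=
  ∀ x : X, ∃ U : X.Opens, x ∈ U ∧
    Nonempty (L.restrict U.ι ≅ (SheafOfModules.free (Fin 1) : U.toScheme.Modules))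

/-- The tensor product over `𝒪_X`: the sheafification of `U ↦ M(U) ⊗ N(U)`. -/
def tensor {X : Scheme.{0}} (M N : X.Modules) : X.Modules :=
  (PresheafOfModules.sheafification (𝟙 X.ringCatSheaf.obj)).obj
    (PresheafOfModules.Monoidal.tensorObj (R := X.presheaf) M.val N.val)

/-- The tensor power `E^{⊗ s}`; the zeroth one is the structure sheaf. -/
def tensorPow {X : Scheme.{0}} (E : X.Modules) : ℕ → X.Modules
  | 0 => SheafOfModules.unit X.ringCatSheaf
  | s + 1 => tensor (tensorPow E s) E

/-- Some family of global sections generates `M`, i.e. induces an epimorphism from a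
free module. -/
def IsGloballyGenerated {X : Scheme.{0}} (M : X.Modules) : Prop :=
  Nonempty (SheafOfModules.GeneratingSections (R := X.ringCatSheaf) M)

/-! ### Degree of a line bundle on an integral curve -/

/-- A section `e` of `M` on `U` is a frame if it is a basis of `M` (which is then free of rank one)
on every open subset of `U`. -/
def IsFrame {X : Scheme.{0}} (M : X.Modules) (U : X.Opens) (e : Γ(M, U)) : Prop :=
  ∀ (V : X.Opens) (h : V ≤ U),
    Function.Bijective (fun a : Γ(X, V) => a • (M.presheaf.map (homOfLE h).op e : Γ(M, V)))

/-- `n` is the order at `z` of the rational section `s` of the line bundle `M` (a section of `M` on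
some nonempty open set `U`, which need not contain `z`): for a frame `e` of `M` near `z` one has
`s = a e` with a rational function `a` whose order of vanishing at `z` is `n`. -/
def HasOrderAt {X : Scheme.{0}} [IsIntegral X] [IsLocallyNoetherian X] (M : X.Modules)
    {U : X.Opens} (s : Γ(M, U)) (z : X) (n : ℤ) : Prop :=
  ∃ (V W : X.Opens) (_ : Nonempty W) (hU : W ≤ U) (hV : W ≤ V) (e : Γ(M, V)) (a : Γ(X, W)),
    z ∈ V ∧ IsFrame M V e ∧
    (M.presheaf.map (homOfLE hU).op s : Γ(M, W)) =
      a • (M.presheaf.map (homOfLE hV).op e : Γ(M, W)) ∧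
    Scheme.ord (X.germToFunctionField W a) z = n

/-- `d` is the degree of the line bundle `M` on the integral curve `C`: the sum, over the closed
points of `C`, of the orders of a nonzero rational section of `M`. Only the points of
codimension one contribute. (For a complete curve over an algebraically closed field every nonzero
rational section gives the same value, and finitely many orders are nonzero.) -/
def HasDegree {C : Scheme.{0}} [IsIntegral C] [IsLocallyNoetherian C] (M : C.Modules) (d : ℤ) :
    Prop :=
  ∃ (U : C.Opens) (_ : Nonempty U) (s : Γ(M, U)) (D : C → ℤ),
    s ≠ 0 ∧ (∀ z : C, Order.coheight z = 1 → HasOrderAt M s z (D z)) ∧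
    (∀ z : C, Order.coheight z ≠ 1 → D z = 0) ∧
    d = ∑ᶠ z : C, D z

/-! ### Nefness -/

/-- A line bundle `L` on a complex scheme `Y` is nef if it has nonnegative degree on every complete
integral curve `C ⊆ Y`. (That `C` is locally Noetherian is automatic.) -/
def IsNefLineBundle {Y : Scheme.{0}} (p : Y ⟶ Spec (.of ℂ)) (L : Y.Modules) : Prop :=
  ∀ (C : Scheme.{0}) [IsIntegral C] [IsLocallyNoetherian C] (i : C ⟶ Y) [IsClosedImmersion i]
    [IsProper (i ≫ p)], topologicalKrullDim C = 1 →
      ∀ d : ℤ, HasDegree ((Scheme.Modules.pullback i).obj L) d → 0 ≤ d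

/-- `π : P ⟶ X` with the line bundle `Q` and the quotient `q : π^*E ⟶ Q` is the projective bundle
`ℙ(E)` of one-dimensional quotients of `E`, with `Q = 𝒪_{ℙ(E)}(1)`: for each `f : T ⟶ X`
and each line bundle quotient `u : f^*E ⟶ N` there is exactly one morphism `g : T ⟶ P` over `X`
such that the pullback of `q` along `g` is isomorphic to `u` as a quotient of `f^*E`. -/
structure IsProjectiveBundle {X P : Scheme.{0}} (E : X.Modules) (π : P ⟶ X) (Q : P.Modules)
    (q : (Scheme.Modules.pullback π).obj E ⟶ Q) : Prop where
  isLineBundle : IsLineBundle Q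
  epi : Epi q
  existsUnique : ∀ (T : Scheme.{0}) (f : T ⟶ X) (N : T.Modules)
    (u : (Scheme.Modules.pullback f).obj E ⟶ N), IsLineBundle N → Epi u →
    ∃! g : T ⟶ P, ∃ (h : g ≫ π = f) (φ : (Scheme.Modules.pullback g).obj Q ≅ N),
      (Scheme.Modules.pullback g).map q ≫ φ.hom =
        (Scheme.Modules.pullbackComp g π).hom.app E ≫
          (Scheme.Modules.pullbackCongr h).hom.app E ≫ u

/-- A vector bundle `E` is nef if the line bundle `𝒪_{ℙ(E)}(1)` on `ℙ(E)` is nef. The projective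
bundle of a vector bundle exists and is unique up to unique isomorphism; we quantify over all
schemes that have its universal property. -/
def IsNef {X : Scheme.{0}} (p : X ⟶ Spec (.of ℂ)) (E : X.Modules) : Prop :=
  ∀ (P : Scheme.{0}) (π : P ⟶ X) (Q : P.Modules) (q : (Scheme.Modules.pullback π).obj E ⟶ Q),
    IsProjectiveBundle E π Q q → IsNefLineBundle (π ≫ p) Q

/-! ### Nonsingular projective varieties -/

/-- The homogeneous coordinate ring `ℂ[x₀, …, xₙ]`, graded by degree. -/
abbrev coordGrading (n : ℕ) : ℕ → Submodule ℂ (MvPolynomial (Fin (n + 1)) ℂ) :=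
  MvPolynomial.homogeneousSubmodule (Fin (n + 1)) ℂ

instance coordGradedAlgebra (n : ℕ) : GradedAlgebra (coordGrading n) :=
  MvPolynomial.gradedAlgebra

/-- Complex projective space of dimension `n`, as `Proj ℂ[x₀, …, xₙ]`. -/
def projectiveSpace (n : ℕ) : Scheme.{0} :=
  Proj (coordGrading n)

/-- The structure morphism of complex projective space. -/
def projectiveSpaceStr (n : ℕ) : projectiveSpace n ⟶ Spec (.of ℂ) :=
  Proj.toSpecZero (coordGrading n) ≫
    Spec.map (CommRingCat.ofHom (algebraMap ℂ (coordGrading n 0)))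

/-- A nonsingular complex projective variety: an integral scheme over `ℂ` with regular local rings
that is isomorphic over `ℂ` to a closed subscheme of some projective space. -/
structure IsNonsingularProjectiveVariety {X : Scheme.{0}} (p : X ⟶ Spec (.of ℂ)) : Prop where
  isIntegral : IsIntegral X
  isProjective : ∃ (n : ℕ) (i : X ⟶ projectiveSpace n),
    IsClosedImmersion i ∧ i ≫ projectiveSpaceStr n = p
  isRegular : ∀ x : X, IsRegularLocalRing (X.presheaf.stalk x)

end NefBundle

end

/-! Let `f : C ⟶ X` be the composite of a complete integral curve in `ℙ(E)` with the projection, and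
let `M` be the pullback of `𝒪(1)` to `C`, a quotient of `f^*E`. The classical argument says that
`M^{⊗ s} ⊗ f^*L` is globally generated for `s ≥ s₀`, so `s · deg M + deg f^*L ≥ 0` for all large
`s`, which forces `deg M ≥ 0`.

The proof runs this argument with rational functions in place of pulled back tensor products. A
frame of `M` near the generic point gives a nonzero morphism `φ` from `M` to the constant sheaf of
the function field `K` of `C`. By adjunction the quotient `f^*E ⟶ M` followed by `φ` becomes a
nonzero morphism `α` from `E` to the direct image of `K` on `X`. A frame of `L` likewise gives a
nonzero `l` from `L` to this direct image. Multiplication in `K` yields a nonzero morphism `α^s · l`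
on `E^{⊗ s} ⊗ L`, and global generation supplies a global section whose value `a ∈ K` is nonzero. If
the values of `φ` and `l` near `z` lie in `𝒪_z b_z` and `𝒪_z c_z`, then `a ∈ 𝒪_z b_z^s c_z`, so
`ord_z a ≥ s · ord_z b_z + ord_z c_z`. A rational section `t` of `M` of order `D_z`, with value `τ`,
satisfies `ord_z τ = D_z + ord_z b_z`. Summing over `z`, and using that `a` and `τ` have degree
zero, gives `∑ ord_z c_z ≤ s · ∑ D_z` with a left side independent of `s`. This is
`nonneg_of_hasDegree`.

The other half is `finsum_ord_eq_zero`: principal divisors on `C` have degree zero. If `C` is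
covered by open sets `U` and `V` on which `a` and `1/a` are regular, with the zeros of each outside
the domain of the other, then both functions define finite morphisms to the affine line, and the
zeros of each are counted by `[K : k(a)]`. A general function is reduced to this case by multiplying
with a high power of a Noether normalization parameter of an affine open set, which has poles at all
points outside that set. -/

noncomputable section

namespace NefBundle

/-! ### Lengths and dimensions -/

/-- Every simple factor of a composition series is the residue field of `O`, which by `hres` is
one-dimensional over `k`, so length and dimension count the same thing. -/
theorem length_eq_finrank_of_residue {k O : Type*} [Field k] [CommRing O] [IsLocalRing O]
    [Algebra k O]
    (hres : ∀ x : O, ∃ c : k, x - algebraMap k O c ∈ IsLocalRing.maximalIdeal O)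
    {M : Type*} [AddCommGroup M] [Module O M] (h : IsFiniteLength O M) :
    ∀ [Module k M] [IsScalarTower k O M],
      Module.Finite k M ∧ Module.length O M = Module.finrank k M := by
  induction h with
  | of_subsingleton =>
    intro _ _
    exact ⟨inferInstance, by simp [Module.length_eq_zero, Module.finrank_zero_of_subsingleton]⟩
  | @of_simple_quotient M _ _ N hs hN ih =>
    intro _ _
    obtain ⟨hf, hl⟩ := ih
    have hQ : Module.finrank k (M ⧸ N) = 1 := by
      have := IsSimpleModule.nontrivial O (M ⧸ N)
      obtain ⟨v, hv⟩ := exists_ne (0 : M ⧸ N)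
      refine finrank_eq_one v hv fun w => ?_
      obtain ⟨x, rfl⟩ := IsSimpleModule.toSpanSingleton_surjective O hv w
      obtain ⟨c, hc⟩ := hres x
      refine ⟨c, ?_⟩
      have hann : Module.annihilator O (M ⧸ N) = IsLocalRing.maximalIdeal O :=
        IsLocalRing.eq_maximalIdeal (IsSimpleModule.annihilator_isMaximal)
      have h0 : (x - algebraMap k O c) • v = 0 := by
        rw [← hann] at hc
        exact Module.mem_annihilator.mp hc v
      rw [sub_smul, sub_eq_zero, algebraMap_smul] at h0
      simpa using h0.symm
    have : Module.Finite k (M ⧸ N) := Module.finite_of_finrank_eq_succ hQ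
    have hN' : Module.Finite k (N.restrictScalars k) := hf
    have hQ' : Module.Finite k (M ⧸ N.restrictScalars k) := this
    have hfin : Module.Finite k M := Module.Finite.of_submodule_quotient (N.restrictScalars k)
    refine ⟨hfin, ?_⟩
    rw [Module.length_eq_add_of_exact N.subtype N.mkQ N.subtype_injective N.mkQ_surjective
      (LinearMap.exact_subtype_mkQ N), hl, Module.length_eq_one]
    have := Submodule.finrank_quotient_add_finrank (N.restrictScalars k)
    have h1 : Module.finrank k (M ⧸ N.restrictScalars k) = 1 := hQ
    have h2 : Module.finrank k (N.restrictScalars k) = Module.finrank k N := rfl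
    rw [← this, h1, h2]
    push_cast
    ring

theorem exists_sub_mem_maximalIdeal {k O : Type*} [Field k] [IsAlgClosed k] [CommRing O]
    [IsLocalRing O] [Algebra k O] [Module.Finite k O] (x : O) :
    ∃ c : k, x - algebraMap k O c ∈ IsLocalRing.maximalIdeal O := by
  have : Module.Finite k (IsLocalRing.ResidueField O) := Module.Finite.of_surjective
    (IsScalarTower.toAlgHom k O (IsLocalRing.ResidueField O)).toLinearMap
    IsLocalRing.residue_surjective
  obtain ⟨c, hc⟩ := (IsAlgClosed.algebraMap_bijective_of_isIntegral
    (k := k) (K := IsLocalRing.ResidueField O)).2 (IsLocalRing.residue O x)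
  refine ⟨c, ?_⟩
  rw [← IsLocalRing.residue_eq_zero_iff, map_sub, ← hc, sub_eq_zero]
  rfl

theorem length_self_eq_finrank {k O : Type*} [Field k] [IsAlgClosed k] [CommRing O]
    [IsLocalRing O] [Algebra k O] [Module.Finite k O] :
    Module.length O O = Module.finrank k O := by
  have : IsArtinianRing O := IsArtinianRing.of_finite k O
  exact (length_eq_finrank_of_residue exists_sub_mem_maximalIdeal
    (isFiniteLength_iff_isNoetherian_isArtinian.mpr ⟨inferInstance, inferInstance⟩)).2

theorem ord_eq_length_of_surjective {O B : Type*} [CommRing O] [CommRing B] (f : O →+* B)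
    (hf : Function.Surjective f) (x : O) (hker : RingHom.ker f = Ideal.span {x}) :
    Ring.ord O x = Module.length B B := by
  algebraize [f]
  rw [Ring.ord, ← Module.length_eq_of_surjective (R := B) (S := O) (M := B) hf, ← hker]
  exact ((Ideal.quotientKerAlgEquivOfSurjective (f := Algebra.ofId O B) hf).toLinearEquiv).length_eq

/-- The dimension of a finite algebra over an algebraically closed field is the sum of the lengths
of its localizations. -/
theorem finrank_eq_sum_length_localization (k R : Type*) [Field k] [IsAlgClosed k] [CommRing R]
    [Algebra k R] [Module.Finite k R] [Fintype (PrimeSpectrum R)] :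
    Module.finrank k R = ∑ p : PrimeSpectrum R,
      (Module.length (Localization.AtPrime p.asIdeal) (Localization.AtPrime p.asIdeal)).toNat := by
  have : IsArtinianRing R := IsArtinianRing.of_finite k R
  have hb := PrimeSpectrum.discreteTopology_iff_toPiLocalization_bijective.mp
    (inferInstance : DiscreteTopology (PrimeSpectrum R))
  let e : R ≃ₐ[R] PrimeSpectrum.PiLocalization R :=
    AlgEquiv.ofBijective (Algebra.ofId _ _) hb
  have hfin : ∀ p : PrimeSpectrum R, Module.Finite k (Localization.AtPrime p.asIdeal) := by
    intro p
    refine Module.Finite.of_surjective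
      (IsScalarTower.toAlgHom k R (Localization.AtPrime p.asIdeal)).toLinearMap fun y => ?_
    classical
    -- An Artinian ring is the product of its localizations, so each localization is a quotient of
    -- `R` and inherits finiteness over `k`.
    obtain ⟨r, hr⟩ := e.surjective (Pi.single p y)
    refine ⟨r, ?_⟩
    have := congr_fun hr p
    rw [Pi.single_eq_same] at this
    exact this
  rw [(e.restrictScalars k).toLinearEquiv.finrank_eq, Module.finrank_pi_fintype]
  refine Finset.sum_congr rfl fun p _ => ?_
  rw [length_self_eq_finrank (k := k)]
  rfl

/-- Localization commutes with quotients: `O / aO` is the localization of `A / (a)` at `p`, and its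
length is by definition the order of `a`. -/
theorem ord_localization_eq_length {A : Type*} [CommRing A] (a : A)
    (p : PrimeSpectrum (A ⧸ Ideal.span {a})) (P : PrimeSpectrum A)
    (hP : P = p.comap (Ideal.Quotient.mk _))
    (O : Type*) [CommRing O] [Algebra A O] [IsLocalization.AtPrime O P.asIdeal] :
    Ring.ord O (algebraMap A O a) =
      Module.length (Localization.AtPrime p.asIdeal) (Localization.AtPrime p.asIdeal) := by
  subst hP
  let I := Ideal.span {a}
  let P := p.comap (Ideal.Quotient.mk I)
  have hloc : IsLocalization (Submonoid.map (Ideal.Quotient.mk I) P.asIdeal.primeCompl)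
      (O ⧸ I.map (algebraMap A O)) :=
    IsLocalization.of_surjective P.asIdeal.primeCompl O (Ideal.Quotient.mk I)
      Ideal.Quotient.mk_surjective (Ideal.Quotient.mk (I.map (algebraMap A O)))
      Ideal.Quotient.mk_surjective rfl (by simp)
  have hM : Submonoid.map (Ideal.Quotient.mk I) P.asIdeal.primeCompl = p.asIdeal.primeCompl := by
    ext x
    constructor
    · rintro ⟨y, hy, rfl⟩
      exact hy
    · intro hx
      obtain ⟨y, rfl⟩ := Ideal.Quotient.mk_surjective x
      exact ⟨y, hx, rfl⟩
  rw [hM] at hloc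
  let e : (O ⧸ I.map (algebraMap A O)) ≃ₐ[A ⧸ I] Localization.AtPrime p.asIdeal :=
    IsLocalization.algEquiv p.asIdeal.primeCompl _ _
  refine ord_eq_length_of_surjective
    ((e : _ →+* Localization.AtPrime p.asIdeal).comp (Ideal.Quotient.mk (I.map (algebraMap A O))))
    (e.surjective.comp Ideal.Quotient.mk_surjective) _ ?_
  ext x
  have : (Ideal.Quotient.mk (I.map (algebraMap A O))) x = 0 ↔
      x ∈ Ideal.span {algebraMap A O a} := by
    rw [Ideal.Quotient.eq_zero_iff_mem, Ideal.map_span, Set.image_singleton]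
  rw [← this]
  simp [RingHom.mem_ker]

theorem ord_localization_eq_zero {A : Type*} [CommRing A] (a : A) (P : PrimeSpectrum A)
    (hP : a ∉ P.asIdeal) (O : Type*) [CommRing O] [Algebra A O]
    [IsLocalization.AtPrime O P.asIdeal] : Ring.ord O (algebraMap A O a) = 0 :=
  Ring.ord_of_isUnit (IsLocalization.map_units O (⟨a, hP⟩ : P.asIdeal.primeCompl))

/-- The primes of the Artinian ring `A / (a)` are the zeros of `a`. Its dimension splits into the
lengths of its local rings, which are the orders of `a`; at all other primes `a` is a unit. -/
theorem finrank_quotient_eq_finsum_ord (k : Type*) {A : Type*} [Field k] [IsAlgClosed k]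
    [CommRing A] [Algebra k A] (a : A) [Module.Finite k (A ⧸ Ideal.span {a})]
    (O : PrimeSpectrum A → Type*) [∀ P, CommRing (O P)] [∀ P, Algebra A (O P)]
    [∀ P : PrimeSpectrum A, IsLocalization.AtPrime (O P) P.asIdeal] :
    (Function.support fun P : PrimeSpectrum A =>
      (Ring.ord (O P) (algebraMap A (O P) a)).toNat).Finite ∧
    ∑ᶠ P : PrimeSpectrum A, (Ring.ord (O P) (algebraMap A (O P) a)).toNat =
      Module.finrank k (A ⧸ Ideal.span {a}) := by
  let R := A ⧸ Ideal.span {a}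
  have : IsArtinianRing R := IsArtinianRing.of_finite k R
  have := Fintype.ofFinite (PrimeSpectrum R)
  let c : PrimeSpectrum R → PrimeSpectrum A := PrimeSpectrum.comap (Ideal.Quotient.mk _)
  have hc : Function.Injective c :=
    PrimeSpectrum.comap_injective_of_surjective _ Ideal.Quotient.mk_surjective
  have hsupp : (Function.support fun P : PrimeSpectrum A =>
      (Ring.ord (O P) (algebraMap A (O P) a)).toNat) ⊆ Set.range c := by
    intro P hP
    rw [range_comap_of_surjective _ _ Ideal.Quotient.mk_surjective]
    rw [Ideal.mk_ker, PrimeSpectrum.mem_zeroLocus, SetLike.coe_subset_coe,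
      Ideal.span_singleton_le_iff_mem]
    by_contra h
    exact hP (by simp [ord_localization_eq_zero a P h (O P)])
  refine ⟨(Set.finite_range c).subset hsupp, ?_⟩
  rw [finrank_eq_sum_length_localization k R, ← finsum_eq_sum_of_fintype]
  rw [← finsum_mem_univ, ← finsum_mem_inter_support_eq' _ (Set.range c) Set.univ, ]
  · rw [finsum_mem_range hc]
    exact finsum_congr fun p => by rw [ord_localization_eq_length a p (c p) rfl (O (c p))]
  · intro P hP
    exact ⟨fun _ => trivial, fun _ => hsupp hP⟩

open IntermediateField Polynomial in
-- Via `X ↦ a` the domain `A` is finite and torsion-free over the principal ideal domain `k[X]`,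
-- hence free of some rank `n`. The dimension of `A / (a)` is the degree of the norm of `a`, and
-- this norm is `X ^ n`. Passing to fraction fields identifies `n` with `[K : k(a)]`.
theorem finrank_quotient_eq_finrank_adjoin {k A K : Type*} [Field k] [CommRing A] [IsDomain A]
    [Algebra k A] [Field K] [Algebra A K] [Algebra k K] [IsScalarTower k A K] [IsFractionRing A K]
    (a : A) (ha : Transcendental k a)
    (hfin : (aeval a : k[X] →ₐ[k] A).toRingHom.Finite) :
    Module.Finite k (A ⧸ Ideal.span {a}) ∧
    Module.finrank k (A ⧸ Ideal.span {a}) = Module.finrank k⟮algebraMap A K a⟯ K := by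
  let φ : k[X] →+* A := (aeval a : k[X] →ₐ[k] A).toRingHom
  algebraize [φ]
  have htower : IsScalarTower k k[X] A := IsScalarTower.of_algebraMap_eq fun c => by
    change _ = aeval a (C c)
    simp
  have hinj : Function.Injective (algebraMap k[X] A) :=
    transcendental_iff_injective.mp ha
  have : FaithfulSMul k[X] A := (faithfulSMul_iff_algebraMap_injective _ _).mpr hinj
  have hX : algebraMap k[X] A X = a := by
    change aeval a X = a
    simp
  have ha0 : a ≠ 0 := by
    rintro rfl
    exact ha (isAlgebraic_zero)
  let b := Module.Free.chooseBasis k[X] A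
  have h1 := finrank_quotient_span_eq_natDegree_norm (F := k) b ha0
  have h2 : (Algebra.norm k[X] a).natDegree = Module.finrank k[X] A := by
    conv_lhs => rw [← hX]
    rw [Algebra.norm_algebraMap]
    simp
  let _ : Algebra k[X] K := ((algebraMap A K).comp (algebraMap k[X] A)).toAlgebra
  have : IsScalarTower k[X] A K := IsScalarTower.of_algebraMap_eq fun _ => rfl
  have h3 : Module.finrank k[X] A = Module.finrank k[X] K :=
    IsFractionRing.finrank_left_eq _ _ K
  have haev : ∀ q : k[X], algebraMap k[X] K q = aeval (algebraMap A K a) q := by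
    intro q
    change algebraMap A K (aeval a q) = _
    rw [aeval_algebraMap_apply]
  let F := k⟮algebraMap A K a⟯
  have hmem : ∀ q : k[X], algebraMap k[X] K q ∈ F := by
    intro q
    rw [haev]
    exact IntermediateField.algebra_adjoin_le_adjoin k _ (aeval_mem_adjoin_singleton k _)
  let _ : Algebra k[X] F := ((algebraMap k[X] K).codRestrict F.toSubring hmem).toAlgebra
  have : IsScalarTower k[X] F K := IsScalarTower.of_algebraMap_eq fun _ => rfl
  have hinjK : Function.Injective (algebraMap k[X] K) :=
    (IsFractionRing.injective A K).comp hinj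
  have hinjF : Function.Injective (algebraMap k[X] F) := fun x y h =>
    hinjK (congrArg (Subtype.val : F → K) h)
  have : FaithfulSMul k[X] F := (faithfulSMul_iff_algebraMap_injective _ _).mpr hinjF
  have : IsFractionRing k[X] F := IsFractionRing.of_field k[X] F fun z => by
    obtain ⟨r, s, hrs⟩ := (IntermediateField.mem_adjoin_simple_iff k _).mp z.2
    refine ⟨r, s, ?_⟩
    apply Subtype.ext
    rw [hrs, ← haev, ← haev]
    rfl
  have h4 : Module.finrank F K = Module.finrank k[X] K := IsFractionRing.finrank_right_eq _ _ _
  refine ⟨?_, by rw [h1, h2, h3, ← h4]⟩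
  let I : Ideal k[X] := Ideal.span {X}
  have hq : Module.Finite k (k[X] ⧸ I) :=
    (Polynomial.monic_X (R := k)).finite_quotient
  have hmap : I.map (algebraMap k[X] A) = Ideal.span {a} := by
    rw [Ideal.map_span, Set.image_singleton, hX]
  rw [← hmap]
  have : Module.Finite (k[X] ⧸ I) (A ⧸ I.map (algebraMap k[X] A)) := inferInstance
  have : IsScalarTower k (k[X] ⧸ I) (A ⧸ I.map (algebraMap k[X] A)) :=
    ⟨fun c q m => by
      obtain ⟨q, rfl⟩ := Ideal.Quotient.mk_surjective q
      obtain ⟨m, rfl⟩ := Ideal.Quotient.mk_surjective m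
      change Ideal.Quotient.mk _ (algebraMap k[X] A (c • q) * m) =
        c • Ideal.Quotient.mk _ (algebraMap k[X] A q * m)
      rw [Algebra.algebraMap_eq_smul_one, smul_assoc, smul_mul_assoc,
        ← Algebra.algebraMap_eq_smul_one]
      rfl⟩
  exact Module.Finite.trans (k[X] ⧸ I) _

/-! ### Valuation rings dominating a local domain of dimension one -/

section LocalDomain

open Polynomial IsLocalRing

variable {O K : Type*} [CommRing O] [IsLocalRing O] [Field K] [Algebra O K]

/-- If the maximal ideal generated a proper ideal of `O[x]`, some valuation ring containing `O[x]`
would have that ideal among its nonunits, contrary to `h`. So it generates the unit ideal, and `1`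
is a polynomial in `x` with coefficients in the maximal ideal. -/
theorem exists_polynomial_coeff_mem_maximalIdeal {x : K}
    (h : ∀ V : ValuationSubring K, (∀ o : O, algebraMap O K o ∈ V) →
      (∀ o ∈ maximalIdeal O, algebraMap O K o ∈ V.nonunits) → x ∉ V) :
    ∃ q : O[X], (∀ i, q.coeff i ∈ maximalIdeal O) ∧ aeval x q = 1 := by
  let B := Algebra.adjoin O {x}
  let I : Ideal B.toSubring := (maximalIdeal O).map (algebraMap O B)
  have hI : I = ⊤ := by
    by_contra hI
    obtain ⟨V, hBV, hV⟩ := Ideal.image_subset_nonunits_valuationSubring I hI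
    refine h V (fun o => hBV (B.algebraMap_mem o)) (fun o ho => hV ?_)
      (hBV (Algebra.subset_adjoin rfl))
    exact ⟨algebraMap O B o, Ideal.mem_map_of_mem _ ho, rfl⟩
  let f : O[X] →ₐ[O] B := aeval ⟨x, Algebra.subset_adjoin rfl⟩
  have hf : Function.Surjective f := by
    intro b
    have hb : (b : K) ∈ Algebra.adjoin O {x} := b.2
    rw [Algebra.adjoin_singleton_eq_range_aeval] at hb
    obtain ⟨q, hq⟩ := hb
    refine ⟨q, Subtype.ext ?_⟩
    rw [← hq]
    exact coe_aeval_mk_apply _ (Algebra.self_mem_adjoin_singleton O x)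
  have hI' : ((maximalIdeal O).map (C : O →+* O[X])).map (f : O[X] →+* B) = ⊤ := by
    rw [Ideal.map_map]
    have hfc : (f : O[X] →+* B).comp C = algebraMap O B := f.comp_algebraMap
    rw [hfc]
    exact hI
  obtain ⟨q, hq, hq1⟩ := (Ideal.mem_map_iff_of_surjective _ hf).mp
    (hI' ▸ Submodule.mem_top : (1 : B) ∈ _)
  refine ⟨q, Ideal.mem_map_C_iff.mp hq, ?_⟩
  have := congrArg B.val hq1
  rw [map_one] at this
  rw [← this]
  exact (coe_aeval_mk_apply _ (Algebra.self_mem_adjoin_singleton O x)).symm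

/-- Multiplying `q(y⁻¹) = 1` by `y ^ d` gives `y ^ d = ∑ qᵢ y ^ (d - i)`. The right side lies in `𝔪
O[y]`, and since `1 - q₀` is a unit the relation can be made monic. -/
theorem isIntegral_and_pow_mem_smul {y : K} (hy : y ≠ 0) {q : O[X]}
    (hq : ∀ i, q.coeff i ∈ maximalIdeal O) (hq1 : aeval y⁻¹ q = 1) :
    IsIntegral O y ∧
      ∃ d, y ^ d ∈ maximalIdeal O • Subalgebra.toSubmodule (Algebra.adjoin O {y}) := by
  set d := q.natDegree
  have key : y ^ d = ∑ i ∈ Finset.range (d + 1), q.coeff i • y ^ (d - i) := by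
    calc y ^ d = y ^ d * aeval y⁻¹ q := by rw [hq1, mul_one]
      _ = _ := by
        rw [aeval_eq_sum_range, Finset.mul_sum]
        refine Finset.sum_congr rfl fun i hi => ?_
        have hi' : i ≤ d := Nat.lt_succ_iff.mp (Finset.mem_range.mp hi)
        rw [mul_smul_comm, inv_pow, pow_sub₀ y hy hi']
  constructor
  · obtain ⟨u, hu⟩ : IsUnit (1 - q.coeff 0) := by
      by_contra hnu
      have h1 : (1 - q.coeff 0) + q.coeff 0 ∈ maximalIdeal O :=
        Ideal.add_mem _ hnu (hq 0)
      rw [sub_add_cancel] at h1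
      exact (Ideal.ne_top_iff_one _).mp (maximalIdeal.isMaximal O).ne_top h1
    have key2 : (u : O) • y ^ d = ∑ i ∈ Finset.range d, q.coeff (i + 1) • y ^ (d - (i + 1)) := by
      rw [Finset.sum_range_succ', Nat.sub_zero] at key
      rw [hu, sub_smul, one_smul, sub_eq_iff_eq_add]
      exact key
    let r : Fin d → O := fun i => (↑u⁻¹ : O) * q.coeff (d - i)
    let p : O[X] := ∑ i : Fin d, C (r i) * X ^ (i : ℕ)
    have hp : p.degree < d := degree_sum_fin_lt r
    refine ⟨X ^ d - p, monic_X_pow_sub hp, ?_⟩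
    rw [← aeval_def, map_sub, sub_eq_zero]
    have hu1 : y ^ d = (↑u⁻¹ : O) • ((u : O) • y ^ d) := by
      rw [smul_smul, Units.inv_mul, one_smul]
    rw [map_pow, aeval_X, hu1, key2, ← Finset.sum_range_reflect, Finset.smul_sum, map_sum,
      Finset.sum_range]
    refine Finset.sum_congr rfl fun i _ => ?_
    have h1 : d - 1 - (i : ℕ) + 1 = d - i := by have := i.2; omega
    have h2 : d - (d - (i : ℕ)) = i := by have := i.2; omega
    rw [h1, h2]
    simp [r, Algebra.smul_def, mul_assoc]
  · refine ⟨d, ?_⟩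
    rw [key]
    refine Submodule.sum_mem _ fun i _ => Submodule.smul_mem_smul (hq i) ?_
    rw [Subalgebra.mem_toSubmodule]
    exact Subalgebra.pow_mem _ (Algebra.self_mem_adjoin_singleton O y) _

theorem exists_denominator_of_isIntegral [IsFractionRing O K] {y : K} (hy : IsIntegral O y) :
    ∃ c : O, c ≠ 0 ∧ ∀ b ∈ Algebra.adjoin O {y}, ∃ o : O, algebraMap O K o = c • b := by
  classical
  obtain ⟨s, hs⟩ := hy.fg_adjoin_singleton
  obtain ⟨c, hc⟩ := IsLocalization.exist_integer_multiples_of_finset (nonZeroDivisors O) s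
  refine ⟨c, nonZeroDivisors.ne_zero c.2, fun b hb => ?_⟩
  have hb' : b ∈ Submodule.span O (s : Set K) := hs ▸ hb
  induction hb' using Submodule.span_induction with
  | mem x hx => exact hc x hx
  | zero => exact ⟨0, by simp⟩
  | add x y hx hy h1 h2 =>
    obtain ⟨o1, h1⟩ := h1 (hs ▸ hx :)
    obtain ⟨o2, h2⟩ := h2 (hs ▸ hy :)
    exact ⟨o1 + o2, by rw [map_add, h1, h2, smul_add]⟩
  | smul r x hx h1 =>
    obtain ⟨o1, h1⟩ := h1 (hs ▸ hx :)
    exact ⟨r * o1, by rw [map_mul, h1, ← Algebra.smul_def, smul_comm]⟩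

variable [IsDomain O] [IsFractionRing O K]

theorem maximalIdeal_pow_le [IsNoetherianRing O] [Ring.KrullDimLE 1 O] {I : Ideal O} (hI : I ≠ ⊥) :
    ∃ n, maximalIdeal O ^ n ≤ I := by
  refine Ideal.exists_pow_le_of_le_radical_of_fg ?_ (IsNoetherian.noetherian _)
  rw [Ideal.radical_eq_sInf]
  refine le_sInf fun p ⟨hp, hprime⟩ => ?_
  have hpb : p ≠ ⊥ := fun h => hI (le_bot_iff.mp (h ▸ hp))
  exact (eq_maximalIdeal (Ring.krullDimLE_one_iff_of_noZeroDivisors.mp ‹_› p hpb hprime)).ge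

/-- If no valuation ring dominating the local ring `O` contains `y⁻¹`, then high powers
of `y` are deep in `O`. -/
theorem exists_pow_mul_mem_maximalIdeal [IsNoetherianRing O] [Ring.KrullDimLE 1 O]
    {y : K} (hy : y ≠ 0)
    (h : ∀ V : ValuationSubring K, (∀ o : O, algebraMap O K o ∈ V) →
      (∀ o ∈ maximalIdeal O, algebraMap O K o ∈ V.nonunits) → y⁻¹ ∉ V) (g : K) :
    ∃ n₀, ∀ n ≥ n₀, ∃ o ∈ maximalIdeal O, algebraMap O K o = y ^ n * g := by
  obtain ⟨q, hq, hq1⟩ := exists_polynomial_coeff_mem_maximalIdeal h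
  obtain ⟨hint, d, hd⟩ := isIntegral_and_pow_mem_smul hy hq hq1
  set B := Algebra.adjoin O {y}
  obtain ⟨c, hc, hcB⟩ := exists_denominator_of_isIntegral hint
  obtain ⟨p, s, hs, rfl⟩ := IsFractionRing.div_surjective (A := O) g
  have hs0 : s ≠ 0 := nonZeroDivisors.ne_zero hs
  have hpow : ∀ k, y ^ (d * k) ∈ maximalIdeal O ^ k • Subalgebra.toSubmodule B := by
    intro k
    induction k with
    | zero => simp
    | succ k ih =>
      have hbw : ∀ b ∈ B, ∀ w ∈ maximalIdeal O • Subalgebra.toSubmodule B,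
          b * w ∈ maximalIdeal O • Subalgebra.toSubmodule B := by
        intro b hb w hw
        refine Submodule.smul_induction_on hw (fun i hi v hv => ?_) fun v w hv hw => ?_
        · rw [mul_smul_comm]
          exact Submodule.smul_mem_smul hi (B.mul_mem hb hv)
        · rw [mul_add]
          exact add_mem hv hw
      rw [mul_add, mul_one, pow_add y, pow_succ (maximalIdeal O), Submodule.mul_smul]
      refine Submodule.smul_induction_on ih (fun i hi b hb => ?_) fun x y hx hy => ?_
      · rw [smul_mul_assoc]
        exact Submodule.smul_mem_smul hi (hbw b hb _ hd)
      · rw [add_mul]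
        exact add_mem hx hy
  -- Here `c` clears the denominators of `O[y]`, `s` is the denominator of `g`, and the extra factor
  -- puts the result into the maximal ideal.
  let I : Ideal O := Ideal.span {c * s} * maximalIdeal O
  obtain ⟨k, hk⟩ : ∃ k, maximalIdeal O ^ k ≤ I := by
    -- When `O` is a field the ideal `I` is zero, so `maximalIdeal_pow_le` does not apply, but the
    -- first power of the maximal ideal already vanishes.
    by_cases hm : maximalIdeal O = ⊥
    · exact ⟨1, by rw [pow_one, hm]; exact bot_le⟩
    · refine maximalIdeal_pow_le ?_
      rw [Ne, Ideal.mul_eq_bot, not_or]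
      exact ⟨by simpa using ⟨hc, hs0⟩, hm⟩
  refine ⟨d * k, fun n hn => ?_⟩
  obtain ⟨r, rfl⟩ := Nat.exists_eq_add_of_le hn
  have hmem : y ^ (d * k + r) ∈ I • Subalgebra.toSubmodule B := by
    have h1 := Submodule.smul_mono_left hk (hpow k)
    rw [pow_add]
    refine Submodule.smul_induction_on h1 (fun i hi b hb => ?_) fun x y hx hy => ?_
    · rw [smul_mul_assoc]
      exact Submodule.smul_mem_smul hi
        (B.mul_mem hb (B.pow_mem (Algebra.subset_adjoin rfl) r))
    · rw [add_mul]
      exact add_mem hx hy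
  have hsK : algebraMap O K s ≠ 0 := by simpa using hs0
  refine Submodule.smul_induction_on hmem (fun i hi b hb => ?_) ?_
  · obtain ⟨m, hm, rfl⟩ := Ideal.mem_span_singleton_mul.mp hi
    obtain ⟨o, ho⟩ := hcB b hb
    refine ⟨p * o * m, Ideal.mul_mem_left _ _ hm, ?_⟩
    rw [map_mul, map_mul, ho]
    simp only [Algebra.smul_def, map_mul]
    field_simp
  · rintro _ _ ⟨o1, hm1, h1⟩ ⟨o2, hm2, h2⟩
    exact ⟨o1 + o2, add_mem hm1 hm2, by rw [map_add, h1, h2, add_mul]⟩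

end LocalDomain

/-! ### Noether normalization in dimension one -/

open Polynomial in
-- Noether normalization makes `A` finite over a polynomial ring in `s` variables. If `s ≥ 2`, a
-- prime of `A` over `(X₀)` is nonzero, hence maximal, so `(X₀)` would be maximal; but it lies
-- strictly inside the ideal of the origin. If `s = 0`, then `A` is integral over a field and so is
-- a field.
theorem exists_transcendental_finite (k : Type*) {A : Type*} [Field k] [CommRing A] [IsDomain A]
    [Algebra k A] [Algebra.FiniteType k A] [Ring.KrullDimLE 1 A] (hA : ¬ IsField A) :
    ∃ x : A, Transcendental k x ∧ (aeval x : k[X] →ₐ[k] A).toRingHom.Finite := by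
  obtain ⟨s, g, hinj, hfin⟩ := exists_finite_inj_algHom_of_fg k A
  have hint : g.toRingHom.IsIntegral := hfin.to_isIntegral
  have hs1 : s ≤ 1 := by
    by_contra hs
    have hs2 : 2 ≤ s := by omega
    algebraize [g.toRingHom]
    have hinj' : Function.Injective (algebraMap (MvPolynomial (Fin s) k) A) := hinj
    let i0 : Fin s := ⟨0, by omega⟩
    let i1 : Fin s := ⟨1, by omega⟩
    let p : Ideal (MvPolynomial (Fin s) k) := Ideal.span {MvPolynomial.X i0}
    have hp : p.IsPrime := (Ideal.span_singleton_prime (MvPolynomial.X_ne_zero i0)).mpr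
      MvPolynomial.X_prime
    obtain ⟨Q, -, hQ, hQp⟩ := Ideal.exists_ideal_over_prime_of_isIntegral p (⊥ : Ideal A) (by
      rw [Ideal.comap_bot_of_injective _ hinj']
      exact bot_le)
    have hQ0 : Q ≠ ⊥ := by
      rintro rfl
      rw [Ideal.comap_bot_of_injective _ hinj'] at hQp
      exact MvPolynomial.X_ne_zero i0 (Ideal.span_singleton_eq_bot.mp hQp.symm)
    have hQm : Q.IsMaximal := Ring.krullDimLE_one_iff_of_noZeroDivisors.mp ‹_› Q hQ0 hQ
    have hpm : p.IsMaximal := hQp ▸ Ideal.isMaximal_comap_of_isIntegral_of_isMaximal Q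
    let ev : MvPolynomial (Fin s) k →+* k := MvPolynomial.eval (fun _ => 0)
    have hker : p = RingHom.ker ev := by
      refine hpm.eq_of_le (RingHom.ker_ne_top _) ?_
      rw [Ideal.span_singleton_le_iff_mem, RingHom.mem_ker]
      simp [ev]
    have h1 : (MvPolynomial.X i1 : MvPolynomial (Fin s) k) ∈ p := by
      rw [hker, RingHom.mem_ker]
      simp [ev]
    rw [Ideal.mem_span_singleton, MvPolynomial.X_dvd_X] at h1
    simp [i0, i1] at h1
  have hs : s = 1 := by
    by_contra hne
    have hs0 : s = 0 := by omega
    subst hs0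
    apply hA
    algebraize [g.toRingHom]
    have hF : IsField (MvPolynomial (Fin 0) k) :=
      (MvPolynomial.isEmptyAlgEquiv k (Fin 0)).toMulEquiv.isField (Field.toIsField k)
    exact isField_of_isIntegral_of_isField' hF
  subst hs
  have hcomp : (aeval (g (MvPolynomial.X 0)) : k[X] →ₐ[k] A) =
      g.comp (aeval (MvPolynomial.X 0)) := by
    ext; simp
  let t : k[X] →ₐ[k] MvPolynomial (Fin 1) k := aeval (MvPolynomial.X 0)
  let t' : MvPolynomial (Fin 1) k →ₐ[k] k[X] := MvPolynomial.aeval fun _ => X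
  have h1 : t'.comp t = AlgHom.id k _ := by ext; simp [t, t']
  have h2 : t.comp t' = AlgHom.id k _ := by
    ext i
    rw [Subsingleton.elim i 0]
    simp [t, t']
  refine ⟨g (MvPolynomial.X 0), ?_, ?_⟩
  · rw [transcendental_iff_injective, hcomp]
    exact hinj.comp (Function.LeftInverse.injective (g := t') fun x => DFunLike.congr_fun h1 x)
  · rw [hcomp]
    exact hfin.comp (RingHom.Finite.of_surjective _
      (Function.RightInverse.surjective (g := t') fun x => DFunLike.congr_fun h2 x))

/-! ### Points of one-dimensional schemes -/

section Points

variable {C : Scheme.{0}} [IsIntegral C]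

theorem krullDim_points (C : Scheme.{0}) : Order.krullDim C = topologicalKrullDim C :=
  (Order.krullDim_eq_of_orderIso (irreducibleSetEquivPoints (α := C))).symm

theorem isMax_iff_eq_genericPoint {z : C} : IsMax z ↔ z = genericPoint C := by
  constructor
  · intro h
    have h1 : z ⤳ genericPoint C := h (genericPoint_specializes z)
    exact (h1.antisymm (genericPoint_specializes z)).eq
  · rintro rfl y -
    exact genericPoint_specializes y

theorem isMin_of_ne_genericPoint (hdim : topologicalKrullDim C = 1) {z : C}
    (hz : z ≠ genericPoint C) : IsMin z := by
  have h1 : Order.krullDim C ≤ 1 := by rw [krullDim_points, hdim]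
  rcases Order.krullDim_le_one_iff.mp h1 z with h | h
  · exact h
  · exact absurd (isMax_iff_eq_genericPoint.mp h) hz

theorem isClosed_singleton_of_ne_genericPoint (hdim : topologicalKrullDim C = 1) {z : C}
    (hz : z ≠ genericPoint C) : IsClosed {z} := by
  have hmin := isMin_of_ne_genericPoint hdim hz
  rw [← closure_subset_iff_isClosed]
  intro y hy
  have h : z ⤳ y := specializes_iff_mem_closure.mpr hy
  have h' : y ⤳ z := hmin h
  exact (h'.antisymm h).eq

theorem coheight_genericPoint : Order.coheight (genericPoint C) = 0 :=
  Order.coheight_eq_zero.mpr (isMax_iff_eq_genericPoint.mpr rfl)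

theorem coheight_eq_one_iff (hdim : topologicalKrullDim C = 1) (z : C) :
    Order.coheight z = 1 ↔ z ≠ genericPoint C := by
  constructor
  · rintro h rfl
    rw [coheight_genericPoint] at h
    exact zero_ne_one h
  · intro hz
    have h1 : (Order.coheight z : WithBot ℕ∞) ≤ 1 := by
      rw [← hdim, ← krullDim_points]
      exact Order.coheight_le_krullDim z
    have h2 : Order.coheight z ≠ 0 := by
      rw [Ne, Order.coheight_eq_zero]
      exact fun h => hz (isMax_iff_eq_genericPoint.mp h)
    exact le_antisymm (by exact_mod_cast h1) (Order.one_le_iff_ne_zero.mpr h2)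

theorem genericPoint_mem (U : C.Opens) [h : Nonempty U] : genericPoint C ∈ U :=
  ((genericPoint_spec C).mem_open_set_iff U.isOpen).mpr (by simpa using h)

theorem exists_ne_genericPoint (hdim : topologicalKrullDim C = 1) :
    ∃ z : C, z ≠ genericPoint C := by
  by_contra! h
  have : Subsingleton C := ⟨fun x y => (h x).trans (h y).symm⟩
  have h2 : Order.krullDim C ≤ 0 := Order.krullDim_nonpos_of_subsingleton
  rw [krullDim_points, hdim] at h2
  exact absurd h2 (by decide)

theorem finite_of_isClosed [NoetherianSpace C] (hdim : topologicalKrullDim C = 1) {Z : Set C}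
    (hZ : IsClosed Z) (hη : genericPoint C ∉ Z) : Z.Finite := by
  obtain ⟨S, hSf, hS, hSirr, rfl⟩ := NoetherianSpace.exists_finite_set_isClosed_irreducible hZ
  refine hSf.sUnion fun t ht => ?_
  obtain ⟨z, hz⟩ := QuasiSober.sober (hSirr t ht) (hS t ht)
  have hzt : z ∈ t := hz.mem
  have hzη : z ≠ genericPoint C := by
    rintro rfl
    exact hη ⟨t, ht, hzt⟩
  rw [← hz.def, (isClosed_singleton_of_ne_genericPoint hdim hzη).closure_eq]
  exact Set.finite_singleton z

theorem finite_compl [NoetherianSpace C] (hdim : topologicalKrullDim C = 1) (U : C.Opens)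
    [Nonempty U] : ((U : Set C)ᶜ).Finite :=
  finite_of_isClosed hdim U.isOpen.isClosed_compl fun h => h (genericPoint_mem U)

end Points

/-! ### Orders of vanishing -/

section Order

variable {C : Scheme.{0}} [IsIntegral C] [IsLocallyNoetherian C]

theorem ord_eq_ringOrd (hdim : topologicalKrullDim C = 1) (z : C) (x : C.presheaf.stalk z)
    (hx : x ≠ 0) :
    Scheme.ord (algebraMap _ C.functionField x) z = ((Ring.ord _ x).toNat : ℤ) := by
  by_cases hz : Order.coheight z = 1
  · have : Ring.KrullDimLE 1 (C.presheaf.stalk z) := krullDimLE_of_coheight_le hz.le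
    have hx' : x ∈ nonZeroDivisors (C.presheaf.stalk z) := mem_nonZeroDivisors_of_ne_zero hx
    have hx'' : algebraMap _ C.functionField x ≠ 0 := by simpa using hx
    rw [Scheme.ord_eq_iff hz hx'']
    change Ring.ordFrac (C.presheaf.stalk z) _ = _
    rw [Ring.ordFrac_eq_ord _ hx]
    obtain ⟨n, hn⟩ := ENat.ne_top_iff_exists.mp (Ring.ord_ne_top hx')
    rw [← hn]
    have h1 := Ring.ordMonoidWithZeroHom_eq_coe _ hx' hn.symm
    exact h1
  -- At the generic point the left side is zero by convention, and the right side is zero because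
  -- the stalk is a field.
  · rw [Scheme.ord_eq_zero_of_coheight_neq_one hz]
    rw [coheight_eq_one_iff hdim, not_not] at hz
    subst hz
    have hu : IsUnit x := by
      exact (isUnit_iff_ne_zero (G₀ := C.functionField) (a := x)).mpr hx
    rw [Ring.ord_of_isUnit hu]
    rfl

open IntermediateField Polynomial in
/-- On an affine open set that is finite over the affine line via `a`, the number of zeros of `a` is
the degree of the function field over the field generated by `a`. -/
theorem finsum_ord_affineOpen {k : Type} [Field k] [IsAlgClosed k]
    (hdim : topologicalKrullDim C = 1) {U : C.Opens} [Nonempty U]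
    (hU : IsAffineOpen U) [Algebra k Γ(C, U)] [Algebra k C.functionField]
    [IsScalarTower k Γ(C, U) C.functionField] (a : Γ(C, U)) (ha : Transcendental k a)
    (hfin : (aeval a : k[X] →ₐ[k] Γ(C, U)).toRingHom.Finite) :
    ((U : Set C) ∩ Function.support (Scheme.ord (C.germToFunctionField U a))).Finite ∧
    ∑ᶠ z ∈ (U : Set C), Scheme.ord (C.germToFunctionField U a) z =
      Module.finrank k⟮C.germToFunctionField U a⟯ C.functionField := by
  have : IsFractionRing Γ(C, U) C.functionField :=
    functionField_isFractionRing_of_isAffineOpen C U hU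
  obtain ⟨hq, hrank⟩ := finrank_quotient_eq_finrank_adjoin (K := C.functionField) a ha hfin
  have hrange : Set.range hU.fromSpec = (U : Set C) := hU.range_fromSpec
  have hmem : ∀ P : PrimeSpectrum Γ(C, U), hU.fromSpec P ∈ U := fun P =>
    hrange.subset ⟨P, rfl⟩
  have hinj : Function.Injective hU.fromSpec := hU.fromSpec.isOpenEmbedding.injective
  let O : PrimeSpectrum Γ(C, U) → Type := fun P => C.presheaf.stalk (hU.fromSpec P)
  let _ : ∀ P, CommRing (O P) := fun P =>
    inferInstanceAs (CommRing (C.presheaf.stalk (hU.fromSpec P)))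
  let _ : ∀ P, Algebra Γ(C, U) (O P) := fun P =>
    TopCat.Presheaf.algebra_section_stalk C.presheaf ⟨hU.fromSpec P, hmem P⟩
  have hO : ∀ P : PrimeSpectrum Γ(C, U), IsLocalization.AtPrime (O P) P.asIdeal := fun P =>
    hU.isLocalization_stalk' P (hmem P)
  obtain ⟨hf, hs⟩ := finrank_quotient_eq_finsum_ord k a O
  have ha0 : a ≠ 0 := by
    rintro rfl
    exact ha isAlgebraic_zero
  have hord : ∀ P : PrimeSpectrum Γ(C, U), Scheme.ord (C.germToFunctionField U a) (hU.fromSpec P) =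
      ((Ring.ord (O P) (algebraMap Γ(C, U) (O P) a)).toNat : ℤ) := by
    intro P
    rw [← Scheme.algebraMap_germ_eq_germToFunctionField C (hmem P), ord_eq_ringOrd hdim]
    · rfl
    · exact fun h => ha0 ((map_eq_zero_iff _ (germ_injective_of_isIntegral C _ (hmem P))).mp h)
  constructor
  · refine (hf.image hU.fromSpec).subset ?_
    rintro z ⟨hz, hz'⟩
    rw [← hrange] at hz
    obtain ⟨P, rfl⟩ := hz
    refine ⟨P, fun h => hz' ?_, rfl⟩
    exact (hord P).trans (by exact_mod_cast h)
  · rw [← hrange, finsum_mem_range hinj]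
    refine (finsum_congr hord).trans (((Nat.castAddMonoidHom ℤ).map_finsum hf).symm.trans ?_)
    exact congrArg (Nat.cast : ℕ → ℤ) (hs.trans hrank)

end Order

/-! ### Constants -/

section Constants

variable {C : Scheme.{0}} {k : Type} [Field k] (p : C ⟶ Spec (.of k))

/-- The structure homomorphism from the base field to the sections on an open set. -/
def constHom (V : C.Opens) : k →+* Γ(C, V) :=
  ((Scheme.ΓSpecIso (.of k)).inv ≫ p.appLE ⊤ V (show V ≤ p ⁻¹ᵁ ⊤ from le_top)).hom

theorem map_constHom {V W : C.Opens} (h : V ≤ W) (c : k) :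
    C.presheaf.map (homOfLE h).op (constHom p W c) = constHom p V c := by
  have h1 := Scheme.Hom.appLE_map (U := ⊤) (V := W) p le_top (homOfLE h).op
  exact congr(($h1).hom ((Scheme.ΓSpecIso (.of k)).inv c))

theorem germ_constHom {V W : C.Opens} (z : C) (hV : z ∈ V) (hW : z ∈ W) (c : k) :
    C.presheaf.germ V z hV (constHom p V c) = C.presheaf.germ W z hW (constHom p W c) := by
  rw [← map_constHom p (le_top : V ≤ ⊤), ← map_constHom p (le_top : W ≤ ⊤)]
  rw [TopCat.Presheaf.germ_res_apply, TopCat.Presheaf.germ_res_apply]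

theorem toSpecΓ_comp_constHom :
    C.toSpecΓ ≫ Spec.map (CommRingCat.ofHom (constHom p ⊤)) = p := by
  have h1 : CommRingCat.ofHom (constHom p ⊤) = (Scheme.ΓSpecIso (.of k)).inv ≫ p.appTop := by
    ext c
    simp [constHom, Scheme.Hom.app_eq_appLE]
  rw [h1, Spec.map_comp, ← Scheme.toSpecΓ_naturality_assoc]
  simp

theorem fromSpecStalk_comp_eq {V : C.Opens} {z : C} (hV : z ∈ V) :
    C.fromSpecStalk z ≫ p = Spec.map (CommRingCat.ofHom
      ((C.presheaf.germ V z hV).hom.comp (constHom p V))) := by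
  have h1 : CommRingCat.ofHom ((C.presheaf.germ V z hV).hom.comp (constHom p V)) =
      CommRingCat.ofHom (constHom p ⊤) ≫ C.presheaf.germ ⊤ z trivial := by
    ext c
    exact germ_constHom p z hV (show z ∈ (⊤ : C.Opens) from trivial) c
  rw [h1, Spec.map_comp, ← Scheme.fromSpecStalk_toSpecΓ, Category.assoc, toSpecΓ_comp_constHom]

/-- The residue field of a closed point is the base field. -/
theorem exists_const_sub_mem_maximalIdeal [IsAlgClosed k] [LocallyOfFiniteType p] {V : C.Opens}
    {z : C} (hV : z ∈ V) (hz : IsClosed {z}) (b : Γ(C, V)) :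
    ∃ c : k, C.presheaf.germ V z hV (b - constHom p V c) ∈
      IsLocalRing.maximalIdeal (C.presheaf.stalk z) := by
  let φ : CommRingCat.of k ⟶ C.residueField z := CommRingCat.ofHom
    (((C.residue z).hom.comp (C.presheaf.germ V z hV).hom).comp (constHom p V))
  -- Over an algebraically closed field the residue field at a closed point is the base field; `φ`
  -- is this isomorphism because it induces the structure morphism on spectra.
  have hφ : φ = (residueFieldIsoBase p z hz).inv := by
    apply Spec.map_injective
    rw [SpecMap_residueFieldIsoBase_inv]
    rw [Scheme.fromSpecResidueField, Category.assoc, fromSpecStalk_comp_eq p hV, ← Spec.map_comp]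
    rfl
  obtain ⟨c, hc⟩ : ∃ c, φ c = C.residue z (C.presheaf.germ V z hV b) := by
    rw [hφ]
    exact ⟨(residueFieldIsoBase p z hz).hom (C.residue z (C.presheaf.germ V z hV b)), by simp⟩
  refine ⟨c, ?_⟩
  rw [map_sub, ← IsLocalRing.residue_eq_zero_iff, map_sub, sub_eq_zero]
  exact hc.symm

end Constants

/-! ### Values of sections along morphisms from affine schemes -/

section EvalAt

variable {C : Scheme.{0}} {R S : Type} [CommRing R] [CommRing S]

/-- The pullback of sections along a morphism from an affine scheme to an open subscheme. -/
def evalAt {U : C.Opens} (m : Spec (.of R) ⟶ U.toScheme) : Γ(C, U) →+* R :=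
  (Spec.preimage (m ≫ U.toSpecΓ)).hom

theorem SpecMap_evalAt {U : C.Opens} (m : Spec (.of R) ⟶ U.toScheme) :
    Spec.map (CommRingCat.ofHom (evalAt m)) = m ≫ U.toSpecΓ :=
  Spec.map_preimage _

theorem evalAt_eq {U : C.Opens} (m : Spec (.of R) ⟶ U.toScheme) {φ : Γ(C, U) →+* R}
    (h : m ≫ U.toSpecΓ = Spec.map (CommRingCat.ofHom φ)) : evalAt m = φ := by
  have h1 := Spec.map_injective ((SpecMap_evalAt m).trans h)
  exact congr(($h1).hom)

theorem evalAt_homOfLE {U W : C.Opens} (h : W ≤ U) (m : Spec (.of R) ⟶ W.toScheme) (s : Γ(C, U)) :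
    evalAt (m ≫ C.homOfLE h) s = evalAt m (C.presheaf.map (homOfLE h).op s) := by
  have h1 : evalAt (m ≫ C.homOfLE h) =
      (evalAt m).comp (C.presheaf.map (homOfLE h).op).hom := by
    apply evalAt_eq
    rw [Category.assoc, ← Scheme.Opens.toSpecΓ_SpecMap_presheaf_map, ← Category.assoc,
      ← SpecMap_evalAt, ← Spec.map_comp]
    rfl
  rw [h1]
  rfl

theorem evalAt_SpecMap {U : C.Opens} (φ : R →+* S) (m : Spec (.of R) ⟶ U.toScheme) (s : Γ(C, U)) :
    evalAt (Spec.map (CommRingCat.ofHom φ) ≫ m) s = φ (evalAt m s) := by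
  have h1 : evalAt (Spec.map (CommRingCat.ofHom φ) ≫ m) = φ.comp (evalAt m) := by
    apply evalAt_eq
    rw [Category.assoc, ← SpecMap_evalAt, ← Spec.map_comp]
    rfl
  rw [h1]
  rfl

theorem isUnit_evalAt_iff [IsLocalRing R] {U : C.Opens} (m : Spec (.of R) ⟶ U.toScheme)
    (s : Γ(C, U)) :
    IsUnit (evalAt m s) ↔ U.ι (m (IsLocalRing.closedPoint R)) ∈ C.basicOpen s := by
  have h1 : m (IsLocalRing.closedPoint R) ∈ U.ι ⁻¹ᵁ C.basicOpen s ↔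
      (m ≫ U.toSpecΓ) (IsLocalRing.closedPoint R) ∈ PrimeSpectrum.basicOpen s := by
    rw [← Scheme.Opens.toSpecΓ_preimage_basicOpen]
    rfl
  refine Iff.trans ?_ h1.symm
  rw [← SpecMap_evalAt]
  change IsUnit (evalAt m s) ↔ evalAt m s ∉ IsLocalRing.maximalIdeal R
  rw [IsLocalRing.mem_maximalIdeal, mem_nonunits_iff, not_not]

end EvalAt

/-! ### The morphism to the affine line defined by a section -/

section Chart

open Polynomial

variable {C : Scheme.{0}} {k : Type} [Field k] (p : C ⟶ Spec (.of k))

theorem toSpecΓ_comp_constHom' (V : C.Opens) :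
    V.toSpecΓ ≫ Spec.map (CommRingCat.ofHom (constHom p V)) = V.ι ≫ p := by
  have h1 : CommRingCat.ofHom (constHom p V) = CommRingCat.ofHom (constHom p ⊤) ≫
      C.presheaf.map (homOfLE le_top).op := by
    ext c
    exact (map_constHom p le_top c).symm
  rw [h1, Spec.map_comp, Scheme.Opens.toSpecΓ_SpecMap_presheaf_map_top_assoc,
    toSpecΓ_comp_constHom]

/-- The morphism to the affine line defined by a section on an open set. -/
def chart (V : C.Opens) (b : Γ(C, V)) : V.toScheme ⟶ Spec (.of k[X]) :=
  V.toSpecΓ ≫ Spec.map (CommRingCat.ofHom (eval₂RingHom (constHom p V) b))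

/-- The projection of the affine line. -/
abbrev affineLineStr (k : Type) [Field k] : Spec (.of k[X]) ⟶ Spec (.of k) :=
  Spec.map (CommRingCat.ofHom Polynomial.C)

theorem chart_comp (V : C.Opens) (b : Γ(C, V)) : chart p V b ≫ affineLineStr k = V.ι ≫ p := by
  rw [← toSpecΓ_comp_constHom', chart, Category.assoc, ← Spec.map_comp]
  congr 2
  ext c
  simp

variable {p} in
theorem evalAt_eq_of_comp_chart {R S : Type} [CommRing R] [CommRing S] {V : C.Opens} {b : Γ(C, V)}
    {m : Spec (.of S) ⟶ V.toScheme} {φ : R →+* S} {i : Spec (.of R) ⟶ Spec (.of k[X])}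
    (h : m ≫ chart p V b = Spec.map (CommRingCat.ofHom φ) ≫ i) :
    evalAt m b = φ ((Spec.preimage i).hom X) := by
  have h1 : Spec.map (CommRingCat.ofHom ((evalAt m).comp (eval₂RingHom (constHom p V) b))) =
      Spec.map (CommRingCat.ofHom (φ.comp (Spec.preimage i).hom)) := by
    rw [CommRingCat.ofHom_comp, CommRingCat.ofHom_comp, Spec.map_comp, Spec.map_comp,
      SpecMap_evalAt, Category.assoc]
    refine Eq.trans h ?_
    rw [CommRingCat.ofHom_hom, Spec.map_preimage]
  have h2 := congr(($(Spec.map_injective h1)).hom X)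
  simpa using h2

/-- If two open sets `U`, `V` cover a proper scheme and `a`, `b` are inverse to each other on
`U ∩ V = D(a)`, then `b : V ⟶ 𝔸¹` is proper. -/
theorem isProper_chart [IsProper p] {U V : C.Opens} (hUV : U ⊔ V = ⊤) (a : Γ(C, U)) (b : Γ(C, V))
    (ha : C.basicOpen a ≤ V)
    (hab : C.presheaf.map (homOfLE inf_le_left : U ⊓ V ⟶ U).op a *
      C.presheaf.map (homOfLE inf_le_right : U ⊓ V ⟶ V).op b = 1)
    [QuasiCompact (chart p V b)] : IsProper (chart p V b) := by
  have hsep : IsSeparated (chart p V b) := by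
    have : IsSeparated (chart p V b ≫ affineLineStr k) := by
      rw [chart_comp]
      infer_instance
    exact IsSeparated.of_comp _ (affineLineStr k)
  have hft : LocallyOfFiniteType (chart p V b) := by
    have : LocallyOfFiniteType (chart p V b ≫ affineLineStr k) := by
      rw [chart_comp]
      infer_instance
    exact locallyOfFiniteType_of_comp _ (affineLineStr k)
  have huc : UniversallyClosed (chart p V b) := by
    apply UniversallyClosed.of_valuativeCriterion
    rintro ⟨R, K, i₁, i₂, ⟨w⟩⟩
    have hp : ValuativeCriterion.Existence p := by
      have h0 : IsProper p := inferInstance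
      rw [IsProper.eq_valuativeCriterion] at h0
      exact h0.1.1.1.existence
    have sq : CommSq (i₁ ≫ V.ι) (Spec.map (CommRingCat.ofHom (algebraMap R K))) p
        (i₂ ≫ affineLineStr k) := ⟨by
      rw [← Category.assoc, ← w, Category.assoc, Category.assoc, chart_comp]⟩
    obtain ⟨⟨l, hl₁, hl₂⟩⟩ := hp ⟨R, K, i₁ ≫ V.ι, i₂ ≫ affineLineStr k, sq⟩
    dsimp only at l hl₁ hl₂
    -- The lift `l` exists because `C` is proper; it remains to see that it stays in `V`. If its
    -- closed point were outside `V`, then `l` would factor through `U`. The value of `a` on `R`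
    -- would be inverse to the coordinate given by `i₂`, hence a unit, and the closed point would
    -- lie in `D(a) ≤ V` after all.
    have hlV : l (IsLocalRing.closedPoint R) ∈ V := by
      by_contra hV
      have hU : l (IsLocalRing.closedPoint R) ∈ U := by
        have : l (IsLocalRing.closedPoint R) ∈ U ⊔ V := hUV ▸ trivial
        exact this.resolve_right hV
      have hrange : Set.range l ⊆ Set.range U.ι := by
        rw [Scheme.Opens.range_ι]
        rintro _ ⟨x, rfl⟩
        exact ((IsLocalRing.specializes_closedPoint x).map l.continuous).mem_open U.isOpen hU
      let lU : Spec (.of R) ⟶ U.toScheme := IsOpenImmersion.lift U.ι l hrange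
      have hlU : lU ≫ U.ι = l := IsOpenImmersion.lift_fac _ _ _
      have hrange' : Set.range (i₁ ≫ V.ι) ⊆ Set.range (U ⊓ V).ι := by
        rw [Scheme.Opens.range_ι]
        rintro _ ⟨x, rfl⟩
        refine ⟨?_, (i₁ x).2⟩
        rw [← hl₁, ← hlU]
        exact (lU _).2
      let m : Spec (.of K) ⟶ (U ⊓ V).toScheme := IsOpenImmersion.lift (U ⊓ V).ι (i₁ ≫ V.ι) hrange'
      have hm : m ≫ (U ⊓ V).ι = i₁ ≫ V.ι := IsOpenImmersion.lift_fac _ _ _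
      have hm1 : m ≫ C.homOfLE inf_le_right = i₁ := by
        rw [← cancel_mono V.ι, Category.assoc, Scheme.homOfLE_ι, hm]
      have hm2 : m ≫ C.homOfLE inf_le_left = Spec.map (CommRingCat.ofHom (algebraMap R K)) ≫ lU := by
        rw [← cancel_mono U.ι, Category.assoc, Scheme.homOfLE_ι, hm, Category.assoc, hlU, hl₁]
      have e1 : evalAt lU a * (Spec.preimage i₂).hom X = 1 := by
        apply IsFractionRing.injective R K
        rw [map_mul, map_one, ← evalAt_SpecMap, ← hm2, ← evalAt_eq_of_comp_chart w, ← hm1,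
          evalAt_homOfLE, evalAt_homOfLE, ← map_mul, hab, map_one]
      have e2 : IsUnit (evalAt lU a) := IsUnit.of_mul_eq_one _ e1
      rw [isUnit_evalAt_iff] at e2
      apply hV
      have e3 := ha e2
      rw [← hlU]
      exact e3
    have hrange : Set.range l ⊆ Set.range V.ι := by
      rw [Scheme.Opens.range_ι]
      rintro _ ⟨x, rfl⟩
      exact ((IsLocalRing.specializes_closedPoint x).map l.continuous).mem_open V.isOpen hlV
    let lV : Spec (.of R) ⟶ V.toScheme := IsOpenImmersion.lift V.ι l hrange
    have hlV' : lV ≫ V.ι = l := IsOpenImmersion.lift_fac _ _ _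
    have c1 : Spec.map (CommRingCat.ofHom (algebraMap R K)) ≫ lV = i₁ := by
      rw [← cancel_mono V.ι, Category.assoc, hlV', hl₁]
    refine ⟨⟨lV, c1, ?_⟩⟩
    dsimp only
    have sq2 : CommSq (i₁ ≫ chart p V b) (Spec.map (CommRingCat.ofHom (algebraMap R K)))
      (affineLineStr k) (l ≫ p) := ⟨by
        rw [Category.assoc, chart_comp, ← Category.assoc, ← Category.assoc, hl₁]⟩
    -- The lower triangle commutes because two morphisms from `Spec R` to the affine line that agree
    -- on `Spec K` and over the base are equal.
    have huniq := IsSeparated.valuativeCriterion (affineLineStr k)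
      ⟨R, K, i₁ ≫ chart p V b, l ≫ p, sq2⟩
    have := huniq.elim ⟨lV ≫ chart p V b, by
      dsimp only; rw [← Category.assoc, c1], by
      dsimp only; rw [Category.assoc, chart_comp, ← Category.assoc, hlV']⟩
      ⟨i₂, w.symm, hl₂.symm⟩
    exact congr(($this).l)
  exact { }

end Chart

/-! ### The degree of a rational function with disjoint zeros and poles -/

theorem compactSpace_of_quasiCompact {C : Scheme.{0}} {k : Type} [Field k]
    (p : C ⟶ Spec (.of k)) [QuasiCompact p] : CompactSpace C :=
  QuasiCompact.compactSpace_of_compactSpace p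

section Constants

variable {C : Scheme.{0}} [IsIntegral C] {k : Type} [Field k] (p : C ⟶ Spec (.of k))

/-- The constants in the function field. -/
def constK : k →+* C.functionField :=
  (C.presheaf.germ ⊤ (genericPoint C) (show genericPoint C ∈ (⊤ : C.Opens) from trivial)).hom.comp
    (constHom p ⊤)

theorem germToFunctionField_constHom (V : C.Opens) [Nonempty V] (c : k) :
    C.germToFunctionField V (constHom p V c) = constK p c :=
  germ_constHom p _ _ _ c

end Constants

section DegreeOfMap

open Polynomial

variable {C : Scheme.{0}} {k : Type} [Field k] (p : C ⟶ Spec (.of k))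

theorem chart_mem_basicOpen (V : C.Opens) (b : Γ(C, V)) (f : k[X]) (v : V.toScheme) :
    chart p V b v ∈ PrimeSpectrum.basicOpen f ↔
      V.ι v ∈ C.basicOpen (f.eval₂ (constHom p V) b) := by
  have h1 : v ∈ V.ι ⁻¹ᵁ C.basicOpen (f.eval₂ (constHom p V) b) ↔
      V.toSpecΓ v ∈ PrimeSpectrum.basicOpen (f.eval₂ (constHom p V) b) := by
    rw [← Scheme.Opens.toSpecΓ_preimage_basicOpen]
    rfl
  exact h1.symm

theorem isAffineOpen_and_finite_of_isFinite_chart {V : C.Opens} {b : Γ(C, V)}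
    (h : IsFinite (chart p V b)) :
    IsAffineOpen V ∧ (eval₂RingHom (constHom p V) b).Finite := by
  have hV : IsAffineOpen V := isAffine_of_isAffineHom (chart p V b)
  refine ⟨hV, ?_⟩
  have h1 : IsIso V.toSpecΓ := hV.isoSpec_hom ▸ inferInstance
  have h2 : IsFinite (inv V.toSpecΓ ≫ chart p V b) := inferInstance
  rw [chart, IsIso.inv_hom_id_assoc, IsFinite.SpecMap_iff] at h2
  exact h2

theorem transcendental_of_forall_ne [IsAlgClosed k] {A : Type} [CommRing A] [IsDomain A] [Algebra k A] {b : A}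
    (hb : ∀ c, b ≠ algebraMap k A c) : Transcendental k b := by
  intro h
  have h1 : IsIntegral k b := h.isIntegral
  obtain ⟨c, hc⟩ := minpoly.mem_range_of_degree_eq_one k b
    (IsAlgClosed.degree_eq_one_of_irreducible k (minpoly.irreducible h1))
  exact hb c hc.symm

variable [IsIntegral C] [IsAlgClosed k]

/-- If a fibre contains a closed point of `C`, where `b` takes a value `c`, then the whole fibre
lies in the zero locus of `b - c`. This is a proper closed subset because `b` is not constant, and
so is finite in dimension one. Any other fibre contains at most the generic point. -/
theorem finite_preimage_chart [NoetherianSpace C] [LocallyOfFiniteType p]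
    (hdim : topologicalKrullDim C = 1) (V : C.Opens) [Nonempty V] (b : Γ(C, V))
    (hb : ∀ c, b ≠ constHom p V c) (y : Spec (.of k[X])) :
    ((chart p V b) ⁻¹' {y}).Finite := by
  by_cases hy : (chart p V b) ⁻¹' {y} ⊆ V.ι ⁻¹' {genericPoint C}
  · exact ((Set.finite_singleton _).preimage V.ι.isOpenEmbedding.injective.injOn).subset hy
  · obtain ⟨v, hv, hv'⟩ := Set.not_subset.mp hy
    have hvV : V.ι v ∈ V := v.2
    obtain ⟨c, hc⟩ := exists_const_sub_mem_maximalIdeal p hvV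
      (isClosed_singleton_of_ne_genericPoint hdim hv') b
    have key : ∀ w : V.toScheme, chart p V b w ∈ PrimeSpectrum.basicOpen (X - Polynomial.C c) ↔
        V.ι w ∈ C.basicOpen (b - constHom p V c) := by
      intro w
      rw [chart_mem_basicOpen]
      simp
    have hvc : V.ι v ∉ C.basicOpen (b - constHom p V c) := by
      rw [Scheme.mem_basicOpen _ _ _ hvV]
      exact hc
    have hfin : ((C.basicOpen (b - constHom p V c) : Set C)ᶜ).Finite := by
      apply finite_of_isClosed hdim (C.basicOpen _).isOpen.isClosed_compl
      intro h
      apply h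
      have h2 : b - constHom p V c ≠ 0 := sub_ne_zero.mpr (hb c)
      refine (Scheme.mem_basicOpen _ _ _ (genericPoint_mem V)).mpr ?_
      refine (isUnit_iff_ne_zero (G₀ := C.functionField)).mpr ?_
      exact fun h => h2 ((map_eq_zero_iff _ (C.germToFunctionField_injective V)).mp h)
    refine (hfin.preimage V.ι.isOpenEmbedding.injective.injOn).subset ?_
    intro w hw hw'
    apply hvc
    have h3 := (key w).mpr hw'
    rw [show chart p V b w = chart p V b v from hw.trans hv.symm] at h3
    exact (key v).mp h3

variable [IsLocallyNoetherian C]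

/-- A proper morphism with finite fibres is finite. -/
theorem isFinite_chart [IsProper p] (hdim : topologicalKrullDim C = 1) {U V : C.Opens} [Nonempty V]
    (hUV : U ⊔ V = ⊤) (a : Γ(C, U)) (b : Γ(C, V)) (ha : C.basicOpen a ≤ V)
    (hab : C.presheaf.map (homOfLE inf_le_left : U ⊓ V ⟶ U).op a *
      C.presheaf.map (homOfLE inf_le_right : U ⊓ V ⟶ V).op b = 1)
    (hb : ∀ c, b ≠ constHom p V c) : IsFinite (chart p V b) := by
  have := compactSpace_of_quasiCompact p
  have : IsNoetherian C := { }
  have := V.ι.isOpenEmbedding.isInducing.noetherianSpace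
  have h1 := isProper_chart p hUV a b ha hab
  have h2 : LocallyQuasiFinite (chart p V b) :=
    .of_finite_preimage_singleton _ (finite_preimage_chart p hdim V b hb)
  exact IsFinite.of_isProper_of_locallyQuasiFinite _

theorem finsum_ord_chart (hdim : topologicalKrullDim C = 1) {V : C.Opens} [Nonempty V]
    (b : Γ(C, V)) (hb : ∀ c, b ≠ constHom p V c) (h : IsFinite (chart p V b)) :
    letI : Algebra k C.functionField := (constK p).toAlgebra
    ((V : Set C) ∩ Function.support (Scheme.ord (C.germToFunctionField V b))).Finite ∧
    ∑ᶠ z ∈ (V : Set C), Scheme.ord (C.germToFunctionField V b) z =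
      Module.finrank (IntermediateField.adjoin k {C.germToFunctionField V b})
        C.functionField := by
  let _ : Algebra k C.functionField := (constK p).toAlgebra
  let _ : Algebra k Γ(C, V) := (constHom p V).toAlgebra
  have : IsScalarTower k Γ(C, V) C.functionField :=
    .of_algebraMap_eq fun c => (germToFunctionField_constHom p V c).symm
  obtain ⟨hV, hf⟩ := isAffineOpen_and_finite_of_isFinite_chart p h
  exact finsum_ord_affineOpen hdim hV b (transcendental_of_forall_ne hb) hf

/-- The zeros of `a` lie in `U` and its poles are the zeros of `b = 1/a` in `V`. Both are fibres
over the origin of finite morphisms to the affine line, and are counted by `[K : k(a)]` and `[K :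
k(b)]`. These agree because `k(a) = k(1/a)`. -/
theorem finsum_ord_eq_zero_of_cover [IsProper p] (hdim : topologicalKrullDim C = 1) {U V : C.Opens} [Nonempty U]
    [Nonempty V] (hUV : U ⊔ V = ⊤) (a : Γ(C, U)) (b : Γ(C, V))
    (ha : C.basicOpen a ≤ V) (hb : C.basicOpen b ≤ U)
    (hab : C.germToFunctionField U a * C.germToFunctionField V b = 1)
    (hc : ∀ c, C.germToFunctionField U a ≠ constK p c) :
    ∑ᶠ z, Scheme.ord (C.germToFunctionField U a) z = 0 := by
  have hη : genericPoint C ∈ U ⊓ V := ⟨genericPoint_mem U, genericPoint_mem V⟩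
  have : Nonempty ↑(U ⊓ V) := ⟨⟨_, hη⟩⟩
  have hab' : C.presheaf.map (homOfLE inf_le_left : U ⊓ V ⟶ U).op a *
      C.presheaf.map (homOfLE inf_le_right : U ⊓ V ⟶ V).op b = 1 := by
    apply C.germToFunctionField_injective (U ⊓ V)
    rw [map_mul, map_one, ← hab]
    congr 1
    · exact TopCat.Presheaf.germ_res_apply _ _ _ _ _
    · exact TopCat.Presheaf.germ_res_apply _ _ _ _ _
  have hba' : C.presheaf.map (homOfLE inf_le_left : V ⊓ U ⟶ V).op b *
      C.presheaf.map (homOfLE inf_le_right : V ⊓ U ⟶ U).op a = 1 := by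
    have : Nonempty ↑(V ⊓ U) := ⟨⟨_, hη.symm⟩⟩
    apply C.germToFunctionField_injective (V ⊓ U)
    rw [map_mul, map_one, ← hab, mul_comm]
    congr 1
    · exact TopCat.Presheaf.germ_res_apply _ _ _ _ _
    · exact TopCat.Presheaf.germ_res_apply _ _ _ _ _
  have hca : ∀ c, a ≠ constHom p U c := by
    rintro c rfl
    exact hc c (germToFunctionField_constHom p U c)
  have hcb : ∀ c, b ≠ constHom p V c := by
    rintro c rfl
    rw [germToFunctionField_constHom] at hab
    refine hc c⁻¹ ?_
    rw [map_inv₀]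
    exact eq_inv_of_mul_eq_one_left hab
  obtain ⟨fa, sa⟩ := finsum_ord_chart p hdim a hca
    (isFinite_chart p hdim (by rwa [sup_comm]) b a hb hba' hca)
  obtain ⟨fb, sb⟩ := finsum_ord_chart p hdim b hcb (isFinite_chart p hdim hUV a b ha hab' hcb)
  set α := C.germToFunctionField U a
  set β := C.germToFunctionField V b
  have hα : α ≠ 0 := left_ne_zero_of_mul_eq_one hab
  have hβ : β ≠ 0 := right_ne_zero_of_mul_eq_one hab
  have hsum : ∀ z, Scheme.ord α z = - Scheme.ord β z := by
    intro z
    rw [eq_neg_iff_add_eq_zero, ← Scheme.ord_mul hα hβ, hab]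
    have : Nonempty (⊤ : C.Opens).toScheme := ⟨⟨z, trivial⟩⟩
    have h1 := Scheme.ord_of_isUnit (U := (⊤ : C.Opens)) (isUnit_one) (x := z) trivial
    rwa [map_one] at h1
  have hzero : ∀ z ∈ U ⊓ V, Scheme.ord α z = 0 := by
    intro z hz
    have h1 := Scheme.ord_of_isUnit (IsUnit.of_mul_eq_one _ hab') hz
    rw [← h1]
    congr 1
    exact (TopCat.Presheaf.germ_res_apply _ _ _ _ _).symm
  have hUc : ∀ z, z ∉ U → z ∈ V := by
    intro z hz
    have : z ∈ U ⊔ V := hUV ▸ trivial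
    exact this.resolve_left hz
  have fV : ((V : Set C) ∩ Function.support (Scheme.ord α)).Finite := by
    have : Function.support (Scheme.ord α) = Function.support (Scheme.ord β) := by
      ext z
      simp [hsum]
    rwa [this]
  have fUc : ((U : Set C)ᶜ ∩ Function.support (Scheme.ord α)).Finite :=
    fV.subset (Set.inter_subset_inter_left _ hUc)
  have h1 : ∑ᶠ z, Scheme.ord α z =
      ∑ᶠ z ∈ (U : Set C), Scheme.ord α z + ∑ᶠ z ∈ (U : Set C)ᶜ, Scheme.ord α z := by
    rw [← finsum_mem_univ, ← Set.union_compl_self (U : Set C),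
      finsum_mem_union' disjoint_compl_right fa fUc]
  -- On `U ∩ V` the function is invertible, so enlarging the complement of `U` to `V` adds only
  -- zeros to the sum.
  have h2 : ∑ᶠ z ∈ (U : Set C)ᶜ, Scheme.ord α z = ∑ᶠ z ∈ (V : Set C), Scheme.ord α z := by
    apply finsum_mem_inter_support_eq'
    intro z hz
    refine ⟨fun h => hUc z h, fun h h' => hz (hzero z ⟨h', h⟩)⟩
  have h3 : ∑ᶠ z ∈ (V : Set C), Scheme.ord α z = - ∑ᶠ z ∈ (V : Set C), Scheme.ord β z := by
    rw [finsum_mem_def, finsum_mem_def, ← finsum_neg_distrib]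
    refine finsum_congr fun z => ?_
    by_cases hz : z ∈ (V : Set C) <;> simp [hz, hsum]
  have h4 : α = β⁻¹ := eq_inv_of_mul_eq_one_left hab
  rw [h1, h2, h3, sa, sb, h4]
  let _ : Algebra k C.functionField := (constK p).toAlgebra
  have h5 : IntermediateField.adjoin k {β⁻¹} = IntermediateField.adjoin k {β} := by
    apply le_antisymm
    · rw [IntermediateField.adjoin_simple_le_iff]
      exact inv_mem (IntermediateField.mem_adjoin_simple_self k β)
    · rw [IntermediateField.adjoin_simple_le_iff]
      simpa using inv_mem (IntermediateField.mem_adjoin_simple_self k β⁻¹)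
  rw [h5]
  ring

end DegreeOfMap

/-! ### The domain of a rational function -/

section Domain

variable {C : Scheme.{0}} [IsIntegral C]

theorem algebraMap_germ_eq {U : C.Opens} {z : C} (hz : z ∈ U) (hη : genericPoint C ∈ U)
    (s : Γ(C, U)) :
    algebraMap (C.presheaf.stalk z) C.functionField (C.presheaf.germ U z hz s) =
      C.presheaf.germ U (genericPoint C) hη s := by
  have : Nonempty U.toScheme := ⟨⟨z, hz⟩⟩
  exact Scheme.algebraMap_germ_eq_germToFunctionField C hz s

/-- The set of points at which a rational function is regular. -/
def regularLocus (f : C.functionField) : C.Opens where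
  carrier := {z | ∃ o : C.presheaf.stalk z, algebraMap _ C.functionField o = f}
  is_open' := by
    rw [isOpen_iff_forall_mem_open]
    rintro z ⟨o, rfl⟩
    obtain ⟨(W : C.Opens), hW, s, rfl⟩ := C.presheaf.exists_germ_eq o
    have : Nonempty W.toScheme := ⟨⟨z, hW⟩⟩
    refine ⟨W, fun w hw => ⟨C.presheaf.germ W w hw s, ?_⟩, W.isOpen, hW⟩
    rw [algebraMap_germ_eq hw (genericPoint_mem W), algebraMap_germ_eq hW (genericPoint_mem W)]

/-- Local representatives of `f` glue because on an integral scheme a section is determined by its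
germ at the generic point. -/
theorem exists_germ_eq_on_regularLocus (f : C.functionField) :
    ∃ (_ : Nonempty (regularLocus f).toScheme) (s : Γ(C, regularLocus f)),
      C.germToFunctionField (regularLocus f) s = f := by
  have hη : genericPoint C ∈ regularLocus f := by
    refine ⟨f, ?_⟩
    obtain ⟨(W : C.Opens), hW, s, rfl⟩ := C.presheaf.exists_germ_eq f
    exact algebraMap_germ_eq hW hW s
  have hloc : ∀ z : regularLocus f, ∃ (W : C.Opens) (hz : z.1 ∈ W) (s : Γ(C, W)),
      W ≤ regularLocus f ∧ C.presheaf.germ W (genericPoint C)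
        (@genericPoint_mem C _ W ⟨⟨z.1, hz⟩⟩) s = f := by
    rintro ⟨z, o, ho⟩
    obtain ⟨(W : C.Opens), hW, s, rfl⟩ := C.presheaf.exists_germ_eq o
    have : Nonempty W.toScheme := ⟨⟨z, hW⟩⟩
    rw [algebraMap_germ_eq hW (genericPoint_mem W)] at ho
    refine ⟨W, hW, s, fun w hw => ⟨C.presheaf.germ W w hw s, ?_⟩, ho⟩
    rw [algebraMap_germ_eq hw (genericPoint_mem W), ho]
  choose W hW s hWf hs using hloc
  have hηW : ∀ z, genericPoint C ∈ W z := fun z => @genericPoint_mem C _ (W z) ⟨⟨z.1, hW z⟩⟩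
  obtain ⟨t, ht, -⟩ := C.sheaf.existsUnique_gluing' W (regularLocus f) (fun z => homOfLE (hWf z))
    (fun z hz => Opens.mem_iSup.mpr ⟨⟨z, hz⟩, hW _⟩) s (by
      intro i j
      apply germ_injective_of_isIntegral C (U := W i ⊓ W j) (genericPoint C) ⟨hηW i, hηW j⟩
      refine (TopCat.Presheaf.germ_res_apply C.presheaf (homOfLE inf_le_left) _ _ (s i)).trans
        (Eq.trans ?_
        (TopCat.Presheaf.germ_res_apply C.presheaf (homOfLE inf_le_right) _ _ (s j)).symm)
      exact (hs i).trans (hs j).symm)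
  refine ⟨⟨⟨_, hη⟩⟩, t, ?_⟩
  have h1 := congrArg (C.presheaf.germ _ (genericPoint C) (hηW _)) (ht ⟨_, hη⟩)
  exact (TopCat.Presheaf.germ_res_apply C.presheaf _ _ _ t).symm.trans (h1.trans (hs _))

end Domain

/-! ### The degree of a principal divisor -/

section Principal

variable {C : Scheme.{0}} [IsIntegral C]

theorem krullDimLE_of_isAffineOpen (hdim : topologicalKrullDim C = 1) {U : C.Opens} [Nonempty U]
    (hU : IsAffineOpen U) : Ring.KrullDimLE 1 Γ(C, U) := by
  rw [Ring.krullDimLE_one_iff_of_noZeroDivisors]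
  intro P hP hP'
  have hPη : hU.fromSpec ⟨P, hP'⟩ ≠ genericPoint C := by
    intro h
    rw [← genericPoint_eq_of_isOpenImmersion hU.fromSpec] at h
    have h1 := hU.fromSpec.isOpenEmbedding.injective h
    rw [genericPoint_eq_bot_of_affine] at h1
    exact hP (congrArg PrimeSpectrum.asIdeal h1)
  have hc := (isClosed_singleton_of_ne_genericPoint hdim hPη).preimage hU.fromSpec.continuous
  have h2 : hU.fromSpec ⁻¹' {hU.fromSpec ⟨P, hP'⟩} = {(⟨P, hP'⟩ : PrimeSpectrum _)} := by
    ext Q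
    exact hU.fromSpec.isOpenEmbedding.injective.eq_iff
  rw [h2] at hc
  exact (PrimeSpectrum.isClosed_singleton_iff_isMaximal _).mp hc

theorem not_isField_of_mem {U : C.Opens} [Nonempty U] (hU : IsAffineOpen U) {z : C}
    (hz : z ∈ U) (hzη : z ≠ genericPoint C) : ¬ IsField Γ(C, U) := by
  intro hF
  have : z ∈ Set.range hU.fromSpec := by
    rw [hU.range_fromSpec]
    exact hz
  obtain ⟨P, rfl⟩ := this
  apply hzη
  rw [← genericPoint_eq_of_isOpenImmersion hU.fromSpec, genericPoint_eq_bot_of_affine]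
  congr 1
  let _ := hF.toField
  exact PrimeSpectrum.ext ((eq_bot_or_eq_top P.asIdeal).resolve_right P.2.ne_top)

theorem specMap_germ_comp_fromSpec {U : C.Opens} [Nonempty U] (hU : IsAffineOpen U) :
    Spec.map (C.germToFunctionField U) ≫ hU.fromSpec = C.fromSpecStalk (genericPoint C) :=
  hU.fromSpecStalk_eq_fromSpecStalk (genericPoint_mem U)

/-- A valuation ring of the function field of a separated scheme dominates at most one point. -/
theorem mem_of_dominates {k : Type} [Field k] (p : C ⟶ Spec (.of k))
    [IsSeparated p] {U : C.Opens} [Nonempty U] (hU : IsAffineOpen U)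
    (V : ValuationSubring C.functionField) {z : C}
    (h1 : ∀ o : C.presheaf.stalk z, algebraMap _ C.functionField o ∈ V)
    (h2 : ∀ o ∈ IsLocalRing.maximalIdeal (C.presheaf.stalk z),
      algebraMap _ C.functionField o ∈ V.nonunits)
    (hA : ∀ a : Γ(C, U), C.germToFunctionField U a ∈ V) : z ∈ U := by
  let j : Spec (.of C.functionField) ⟶ Spec (.of V) :=
    Spec.map (CommRingCat.ofHom (algebraMap V C.functionField))
  let φ₁ : C.presheaf.stalk z ⟶ .of V := CommRingCat.ofHom
    ((algebraMap (C.presheaf.stalk z) C.functionField).codRestrict V.toSubring h1)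
  let φ₂ : Γ(C, U) ⟶ .of V := CommRingCat.ofHom
    ((C.germToFunctionField U).hom.codRestrict V.toSubring hA)
  -- Two morphisms from `Spec V` to `C`, one through the stalk at `z` and one through `U`, agree on
  -- the spectrum of the function field and hence are equal by separatedness. The first sends the
  -- closed point to `z` because `V` dominates the stalk; the second sends it into `U`.
  let m₁ : Spec (.of V) ⟶ C := Spec.map φ₁ ≫ C.fromSpecStalk z
  let m₂ : Spec (.of V) ⟶ C := Spec.map φ₂ ≫ hU.fromSpec
  have e₁ : j ≫ m₁ = C.fromSpecStalk (genericPoint C) := by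
    rw [← Category.assoc, ← Spec.map_comp]
    exact C.SpecMap_stalkSpecializes_fromSpecStalk (genericPoint_specializes z)
  have e₂ : j ≫ m₂ = C.fromSpecStalk (genericPoint C) := by
    rw [← Category.assoc, ← Spec.map_comp]
    exact specMap_germ_comp_fromSpec hU
  have e₃ : m₂ ≫ p = m₁ ≫ p := by
    have h3 : j ≫ (m₂ ≫ p) = j ≫ (m₁ ≫ p) := by
      rw [← Category.assoc, e₂, ← Category.assoc, e₁]
    rw [← Spec.map_preimage (m₂ ≫ p), ← Spec.map_preimage (m₁ ≫ p), ← Spec.map_comp,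
      ← Spec.map_comp] at h3
    have h4 := Spec.map_injective h3
    rw [← Spec.map_preimage (m₂ ≫ p), ← Spec.map_preimage (m₁ ≫ p)]
    congr 1
    ext c
    have h5 := congr(($h4).hom c)
    exact h5
  have e₄ : m₁ = m₂ := by
    have sq : CommSq (C.fromSpecStalk (genericPoint C)) j p (m₁ ≫ p) := ⟨by
      rw [← e₁, Category.assoc]⟩
    have := (IsSeparated.valuativeCriterion p ⟨V, C.functionField, _, _, sq⟩).elim
      ⟨m₁, e₁, rfl⟩ ⟨m₂, e₂, e₃⟩
    exact congr(($this).l)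
  have hloc : IsLocalHom φ₁.hom := by
    refine ⟨fun o ho => ?_⟩
    by_contra hu
    have h3 := h2 o hu
    rw [ValuationSubring.mem_nonunits_iff_exists_mem_maximalIdeal] at h3
    obtain ⟨h3, h4⟩ := h3
    exact h4 ho
  have h5 : m₁ (IsLocalRing.closedPoint V) = z := by
    change C.fromSpecStalk z (Spec.map φ₁ (IsLocalRing.closedPoint V)) = z
    have h6 : Spec.map φ₁ (IsLocalRing.closedPoint V) = IsLocalRing.closedPoint _ :=
      IsLocalRing.comap_closedPoint φ₁.hom
    rw [h6, Scheme.fromSpecStalk_closedPoint]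
  rw [← h5, e₄]
  have h7 : hU.fromSpec (Spec.map φ₂ (IsLocalRing.closedPoint V)) ∈ Set.range hU.fromSpec :=
    ⟨_, rfl⟩
  rw [hU.range_fromSpec] at h7
  exact h7

variable [IsLocallyNoetherian C]

theorem finite_support_ord [NoetherianSpace C] (hdim : topologicalKrullDim C = 1)
    {f : C.functionField} (hf : f ≠ 0) : (Function.support (Scheme.ord f)).Finite := by
  obtain ⟨U, -, f', _, rfl, hu⟩ := exists_isUnit_germ_eq C f hf
  refine (finite_compl hdim U).subset fun z hz hzU => hz ?_
  exact Scheme.ord_of_isUnit hu hzU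

theorem ord_one (z : C) : Scheme.ord (1 : C.functionField) z = 0 := by
  have : Nonempty (⊤ : C.Opens).toScheme := ⟨⟨z, trivial⟩⟩
  have h1 := Scheme.ord_of_isUnit (U := (⊤ : C.Opens)) (isUnit_one) (x := z) trivial
  rwa [map_one] at h1

variable {k : Type} [Field k] (p : C ⟶ Spec (.of k))

theorem ord_constK {c : k} (hc : c ≠ 0) (z : C) : Scheme.ord (constK p c) z = 0 := by
  have : Nonempty (⊤ : C.Opens).toScheme := ⟨⟨z, trivial⟩⟩
  exact Scheme.ord_of_isUnit (U := (⊤ : C.Opens)) ((IsUnit.mk0 c hc).map (constHom p ⊤))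
    (x := z) trivial

/-- The hypothesis `h` says that `a` has a pole at every point outside `U`. Hence `U` and the
regular locus of `1/a` cover `C`, as `finsum_ord_eq_zero_of_cover` requires. Constants are treated
apart, since they define no finite morphism. -/
theorem finsum_ord_eq_zero_of_forall_notMem [IsAlgClosed k] [IsProper p]
    (hdim : topologicalKrullDim C = 1) {U : C.Opens} [Nonempty U] (a : Γ(C, U))
    (ha : a ≠ 0)
    (h : ∀ z ∉ U, ∃ o ∈ IsLocalRing.maximalIdeal (C.presheaf.stalk z),
      algebraMap _ C.functionField o = (C.germToFunctionField U a)⁻¹) :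
    ∑ᶠ z, Scheme.ord (C.germToFunctionField U a) z = 0 := by
  have ha' : C.germToFunctionField U a ≠ 0 := fun h0 =>
    ha ((map_eq_zero_iff _ (C.germToFunctionField_injective U)).mp h0)
  by_cases hc : ∃ c, C.germToFunctionField U a = constK p c
  · obtain ⟨c, hc⟩ := hc
    have hc0 : c ≠ 0 := by
      rintro rfl
      exact ha' (hc.trans (map_zero _))
    rw [hc]
    exact finsum_eq_zero_of_forall_eq_zero fun z => ord_constK p hc0 z
  · push Not at hc
    obtain ⟨hne, b, hb⟩ := exists_germ_eq_on_regularLocus (C.germToFunctionField U a)⁻¹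
    refine finsum_ord_eq_zero_of_cover p hdim ?_ a b ?_ ?_ (by rw [hb, mul_inv_cancel₀ ha']) hc
    · refine eq_top_iff.mpr fun z _ => ?_
      by_cases hz : z ∈ U
      · exact Or.inl hz
      · obtain ⟨o, -, ho⟩ := h z hz
        exact Or.inr ⟨o, ho⟩
    · intro z hz
      obtain ⟨hzU, hu⟩ := (Scheme.mem_basicOpen'' _ _ _).mp hz
      refine ⟨(hu.unit⁻¹ : _ˣ), ?_⟩
      apply eq_inv_of_mul_eq_one_left
      rw [← Scheme.algebraMap_germ_eq_germToFunctionField C hzU a,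
        ← map_mul, IsUnit.val_inv_mul, map_one]
    · intro z hz
      obtain ⟨hzV, hu⟩ := (Scheme.mem_basicOpen'' _ _ _).mp hz
      by_contra hzU
      obtain ⟨o, ho, ho'⟩ := h z hzU
      rw [← hb, ← Scheme.algebraMap_germ_eq_germToFunctionField C hzV b] at ho'
      have h2 := IsFractionRing.injective _ _ ho'
      rw [h2] at ho
      exact ho hu

open Polynomial in
/-- The degree of a principal divisor on a complete integral curve is zero. -/
theorem finsum_ord_eq_zero [IsAlgClosed k] [IsProper p] (hdim : topologicalKrullDim C = 1)
    {f : C.functionField} (hf : f ≠ 0) : ∑ᶠ z, Scheme.ord f z = 0 := by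
  have := compactSpace_of_quasiCompact p
  have : IsNoetherian C := { }
  have hmul : ∀ {f g : C.functionField}, f ≠ 0 → g ≠ 0 →
      ∑ᶠ z, Scheme.ord (f * g) z = ∑ᶠ z, Scheme.ord f z + ∑ᶠ z, Scheme.ord g z := by
    intro f g hf hg
    rw [← finsum_add_distrib (finite_support_ord hdim hf) (finite_support_ord hdim hg)]
    exact finsum_congr fun z => Scheme.ord_mul hf hg
  obtain ⟨z₀, hz₀⟩ := exists_ne_genericPoint hdim
  obtain ⟨_, ⟨(U : C.Opens), hU, rfl⟩, hzU, -⟩ :=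
    C.isBasis_affineOpens.exists_subset_of_mem_open (Set.mem_univ z₀) isOpen_univ
  have : Nonempty U.toScheme := ⟨⟨z₀, hzU⟩⟩
  have hU : IsAffineOpen U := hU
  have := krullDimLE_of_isAffineOpen hdim hU
  have : IsFractionRing Γ(C, U) C.functionField :=
    functionField_isFractionRing_of_isAffineOpen C U hU
  let _ : Algebra k Γ(C, U) := (constHom p U).toAlgebra
  have : Algebra.FiniteType k Γ(C, U) := by
    have h1 := p.finiteType_appLE (isAffineOpen_top _) hU (show U ≤ p ⁻¹ᵁ ⊤ from le_top)
    have h2 : (constHom p U).FiniteType :=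
      h1.comp (RingHom.FiniteType.of_surjective _
        (Scheme.ΓSpecIso (.of k)).commRingCatIsoToRingEquiv.symm.surjective)
    exact h2
  obtain ⟨x, hx, hfin⟩ := exists_transcendental_finite k (not_isField_of_mem hU hzU hz₀)
  have hx0 : x ≠ 0 := by
    rintro rfl
    exact hx isAlgebraic_zero
  have hinj : ∀ {a : Γ(C, U)}, a ≠ 0 → C.germToFunctionField U a ≠ 0 := fun ha h0 =>
    ha ((map_eq_zero_iff _ (C.germToFunctionField_injective U)).mp h0)
  set ξ := C.germToFunctionField U x
  have hξ : ξ ≠ 0 := hinj hx0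
  -- A valuation ring dominating the stalk at `z ∉ U` cannot contain `ξ`. Otherwise, being
  -- integrally closed, it would contain the sections on `U`, which are integral over `k[x]`, and
  -- `mem_of_dominates` would put `z` in `U`.
  have hdom : ∀ z ∉ U, ∀ g : C.functionField, ∃ n₀, ∀ n ≥ n₀,
      ∃ o ∈ IsLocalRing.maximalIdeal (C.presheaf.stalk z),
        algebraMap _ C.functionField o = ξ⁻¹ ^ n * g := by
    intro z hz g
    have hzη : z ≠ genericPoint C := fun h => hz (h ▸ genericPoint_mem U)
    have : Ring.KrullDimLE 1 (C.presheaf.stalk z) :=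
      krullDimLE_of_coheight_le ((coheight_eq_one_iff hdim z).mpr hzη).le
    refine exists_pow_mul_mem_maximalIdeal (inv_ne_zero hξ) (fun V h1 h2 h3 => hz ?_) g
    rw [inv_inv] at h3
    refine mem_of_dominates p hU V h1 h2 fun a => ?_
    let φ : k[X] →+* V := eval₂RingHom ((constK p).codRestrict V.toSubring fun c => by
      have := h1 (C.presheaf.germ ⊤ z trivial (constHom p ⊤ c))
      rw [algebraMap_germ_eq (U := ⊤) trivial trivial] at this
      exact this) ⟨ξ, h3⟩
    have hφ : (algebraMap V C.functionField).comp φ =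
        (C.germToFunctionField U).hom.comp (aeval x : k[X] →ₐ[k] Γ(C, U)).toRingHom := by
      ext c
      · simp only [RingHom.comp_apply, φ, coe_eval₂RingHom, eval₂_C]
        refine (germToFunctionField_constHom p U c).symm.trans ?_
        congr 1
        exact (aeval_C x c).symm
      · simp only [RingHom.comp_apply, φ, coe_eval₂RingHom, eval₂_X]
        exact congrArg (C.germToFunctionField U) (aeval_X x).symm
    obtain ⟨q, hq, hq'⟩ := hfin.to_isIntegral a
    have hint : _root_.IsIntegral V (C.germToFunctionField U a) := by
      refine ⟨q.map φ, hq.map φ, ?_⟩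
      rw [eval₂_map, hφ, ← hom_eval₂]
      exact (congrArg _ hq').trans (map_zero _)
    obtain ⟨v, hv⟩ := IsIntegrallyClosed.isIntegral_iff.mp hint
    rw [← hv]
    exact v.2
  -- Only finitely many points lie outside `U`, so one exponent gives `a * x ^ n` a pole at all of
  -- them.
  have key : ∀ a : Γ(C, U), a ≠ 0 → ∃ n₀, ∀ n ≥ n₀,
      ∑ᶠ z, Scheme.ord (C.germToFunctionField U a * ξ ^ n) z = 0 := by
    intro a ha
    choose n hn using fun z : ((U : Set C)ᶜ : Set C) => hdom z z.2 (C.germToFunctionField U a)⁻¹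
    have : Finite ((U : Set C)ᶜ : Set C) := finite_compl hdim U
    obtain ⟨N, hN⟩ := (Set.finite_range n).bddAbove
    refine ⟨N, fun m hm => ?_⟩
    rw [← map_pow, ← map_mul]
    refine finsum_ord_eq_zero_of_forall_notMem p hdim _
      (mul_ne_zero ha (pow_ne_zero m hx0)) fun z hz => ?_
    obtain ⟨o, ho, ho'⟩ := hn ⟨z, hz⟩ m ((hN ⟨_, rfl⟩).trans hm)
    refine ⟨o, ho, ho'.trans ?_⟩
    rw [map_mul, map_pow, mul_inv, inv_pow, mul_comm]
  have key2 : ∀ a : Γ(C, U), a ≠ 0 → ∑ᶠ z, Scheme.ord (C.germToFunctionField U a) z = 0 := by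
    intro a ha
    obtain ⟨n₁, h1⟩ := key a ha
    -- Both `a * x ^ n` and `x ^ n` have degree zero for a common large `n`, hence so does `a`.
    obtain ⟨n₂, h2⟩ := key 1 one_ne_zero
    have h1 := h1 (n₁ + n₂) (by omega)
    have h2 := h2 (n₁ + n₂) (by omega)
    rw [map_one, one_mul] at h2
    rw [hmul (hinj ha) (pow_ne_zero _ hξ), h2, add_zero] at h1
    exact h1
  obtain ⟨a, b, hb, rfl⟩ := IsFractionRing.div_surjective (A := Γ(C, U)) f
  have hb0 : b ≠ 0 := nonZeroDivisors.ne_zero hb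
  have ha0 : a ≠ 0 := by
    rintro rfl
    exact hf (by rw [map_zero, zero_div])
  have h1 := key2 a ha0
  have h2 := hmul hf (hinj hb0)
  rw [key2 b hb0, add_zero] at h2
  rw [← h2, ← h1]
  refine finsum_congr fun z => ?_
  congr 1
  exact div_mul_cancel₀ _ (hinj hb0)

end Principal

/-! ### Morphisms of modules -/

section Hom

variable {X : Scheme.{0}}

/-- A morphism of sheaves of modules from its action on sections. -/
def modHomMk {M N : X.Modules} (φ : ∀ U : X.Opens, Γ(M, U) →+ Γ(N, U))
    (hmap : ∀ (U V : X.Opens) (h : V ≤ U) (m : Γ(M, U)),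
      φ V (M.presheaf.map (homOfLE h).op m) = N.presheaf.map (homOfLE h).op (φ U m))
    (hsmul : ∀ (U : X.Opens) (r : Γ(X, U)) (m : Γ(M, U)), φ U (r • m) = r • φ U m) : M ⟶ N :=
  ⟨PresheafOfModules.homMk
    { app := fun U => AddCommGrpCat.ofHom (φ U.unop)
      naturality := fun U V i => by
        ext m
        exact hmap _ _ (leOfHom i.unop) m } (fun U r m => hsmul U.unop r m)⟩

theorem hom_app_map {M N : X.Modules} (α : M ⟶ N) {U V : X.Opens} (h : V ≤ U) (m : Γ(M, U)) :
    α.app V (M.presheaf.map (homOfLE h).op m) = N.presheaf.map (homOfLE h).op (α.app U m) :=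
  congr($(α.mapPresheaf.naturality (homOfLE h).op) m)

theorem map_map {M : X.Modules} {U V W : X.Opens} (h : V ≤ U) (h' : W ≤ V) (m : Γ(M, U)) :
    M.presheaf.map (homOfLE h').op (M.presheaf.map (homOfLE h).op m) =
      M.presheaf.map (homOfLE (h'.trans h)).op m :=
  congr($(M.presheaf.map_comp (homOfLE h).op (homOfLE h').op) m).symm

theorem map_self {M : X.Modules} {U : X.Opens} (h : U ≤ U) (m : Γ(M, U)) :
    M.presheaf.map (homOfLE h).op m = m :=
  congr($(M.presheaf.map_id (.op U)) m)

end Hom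

/-! ### Coordinates with respect to a frame -/

section Frame

variable {X : Scheme.{0}} {M : X.Modules} {V : X.Opens} {e : Γ(M, V)}

/-- The coordinate of a section with respect to a frame. -/
def IsFrame.coord (he : IsFrame M V e) {W : X.Opens} (h : W ≤ V) (m : Γ(M, W)) : Γ(X, W) :=
  ((he W h).2 m).choose

theorem IsFrame.coord_smul (he : IsFrame M V e) {W : X.Opens} (h : W ≤ V) (m : Γ(M, W)) :
    he.coord h m • (M.presheaf.map (homOfLE h).op e : Γ(M, W)) = m :=
  ((he W h).2 m).choose_spec

theorem IsFrame.coord_eq (he : IsFrame M V e) {W : X.Opens} (h : W ≤ V) {m : Γ(M, W)} {a : Γ(X, W)}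
    (ha : a • (M.presheaf.map (homOfLE h).op e : Γ(M, W)) = m) : he.coord h m = a :=
  (he W h).1 ((he.coord_smul h m).trans ha.symm)

theorem IsFrame.coord_add (he : IsFrame M V e) {W : X.Opens} (h : W ≤ V) (m n : Γ(M, W)) :
    he.coord h (m + n) = he.coord h m + he.coord h n :=
  he.coord_eq h (by rw [add_smul, he.coord_smul, he.coord_smul])

theorem IsFrame.coord_smul' (he : IsFrame M V e) {W : X.Opens} (h : W ≤ V) (a : Γ(X, W))
    (m : Γ(M, W)) : he.coord h (a • m) = a * he.coord h m :=
  he.coord_eq h (by rw [mul_smul, he.coord_smul])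

theorem IsFrame.coord_map (he : IsFrame M V e) {W W' : X.Opens} (h : W ≤ V) (h' : W' ≤ W)
    (m : Γ(M, W)) : he.coord (h'.trans h) (M.presheaf.map (homOfLE h').op m) =
      X.presheaf.map (homOfLE h').op (he.coord h m) := by
  apply he.coord_eq
  conv_rhs => rw [← he.coord_smul h m]
  rw [Scheme.Modules.map_smul, map_map]

theorem IsFrame.coord_self (he : IsFrame M V e) : he.coord le_rfl e = 1 :=
  he.coord_eq _ (by rw [one_smul, map_self])

variable {T : Scheme.{0}} (h : T ⟶ X)

/-- The direct image of the structure sheaf. -/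
abbrev pushUnit : X.Modules :=
  (Scheme.Modules.pushforward h).obj (SheafOfModules.unit T.ringCatSheaf)

/-- Sections of the direct image of the structure sheaf. -/
def pushUnitEquiv (U : X.Opens) : Γ(pushUnit h, U) ≃+ Γ(T, h ⁻¹ᵁ U) := AddEquiv.refl _

theorem pushUnitEquiv_smul (U : X.Opens) (a : Γ(X, U)) (m : Γ(pushUnit h, U)) :
    pushUnitEquiv h U (a • m) = h.app U a * pushUnitEquiv h U m := rfl

theorem pushUnitEquiv_map {U V : X.Opens} (i : V ≤ U) (m : Γ(pushUnit h, U)) :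
    pushUnitEquiv h V ((pushUnit h).presheaf.map (homOfLE i).op m) =
      T.presheaf.map (homOfLE (h.preimage_mono i)).op (pushUnitEquiv h U m) := rfl

/-- The morphism to the direct image of the structure sheaf given by the coordinate with respect
to a frame. -/
def IsFrame.toPushUnit (he : IsFrame M V e) (hV : ⊤ ≤ h ⁻¹ᵁ V) : M ⟶ pushUnit h :=
  modHomMk (fun U => AddMonoidHom.mk' (fun m => (pushUnitEquiv h U).symm
      (h.appLE (U ⊓ V) (h ⁻¹ᵁ U) (show h ⁻¹ᵁ U ≤ h ⁻¹ᵁ (U ⊓ V) from le_inf le_rfl (le_top.trans hV))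
        (he.coord inf_le_right (M.presheaf.map (homOfLE inf_le_left).op m)))) fun m n => by
      rw [map_add, he.coord_add, map_add, map_add])
    (fun U U' i m => by
      apply (pushUnitEquiv h U').injective
      simp only [AddMonoidHom.mk'_apply, AddEquiv.apply_symm_apply]
      rw [pushUnitEquiv_map, AddEquiv.apply_symm_apply, map_map]
      have h1 := he.coord_map inf_le_right (inf_le_inf_right V i)
        (M.presheaf.map (homOfLE inf_le_left).op m)
      rw [map_map] at h1
      rw [h1]
      rw [← CommRingCat.comp_apply, ← CommRingCat.comp_apply, Scheme.Hom.map_appLE,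
        Scheme.Hom.appLE_map])
    (fun U r m => by
      apply (pushUnitEquiv h U).injective
      simp only [AddMonoidHom.mk'_apply]
      rw [pushUnitEquiv_smul, AddEquiv.apply_symm_apply, AddEquiv.apply_symm_apply,
        Scheme.Modules.map_smul, he.coord_smul', map_mul]
      congr 1
      rw [← CommRingCat.comp_apply, Scheme.Hom.map_appLE, Scheme.Hom.app_eq_appLE])

theorem IsFrame.toPushUnit_self (he : IsFrame M V e) (hV : ⊤ ≤ h ⁻¹ᵁ V) :
    pushUnitEquiv h V ((he.toPushUnit h hV).app V e) = 1 := by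
  change h.appLE (V ⊓ V) (h ⁻¹ᵁ V) _ (he.coord inf_le_right _) = 1
  have h1 := he.coord_map le_rfl (inf_le_left : V ⊓ V ≤ V) e
  rw [he.coord_self, map_one] at h1
  rw [h1, map_one]

end Frame

/-! ### Products of morphisms to the direct image of the structure sheaf -/

section TensorDesc

open MonoidalCategory

variable {D : Type} [Category.{0} D] {R : Dᵒᵖ ⥤ CommRingCat.{0}}
  {N₁ N₂ G : PresheafOfModules.{0} (R ⋙ forget₂ CommRingCat RingCat)}

/-- A morphism out of a tensor product of presheaves of modules from a bilinear map. -/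
def presheafTensorDesc (b : ∀ U : Dᵒᵖ, N₁.obj U → N₂.obj U → G.obj U)
    (h₁ : ∀ U m m' n, b U (m + m') n = b U m n + b U m' n)
    (h₂ : ∀ U (r : R.obj U) m n, b U (r • m) n = r • b U m n)
    (h₃ : ∀ U m n n', b U m (n + n') = b U m n + b U m n')
    (h₄ : ∀ U (r : R.obj U) m n, b U m (r • n) = r • b U m n)
    (hmap : ∀ (U V : Dᵒᵖ) (i : U ⟶ V) m n,
      b V (N₁.map i m) (N₂.map i n) = G.map i (b U m n)) :
    PresheafOfModules.Monoidal.tensorObj N₁ N₂ ⟶ G where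
  app U := ModuleCat.MonoidalCategory.tensorLift (R := R.obj U) (b U) (h₁ U) (h₂ U) (h₃ U) (h₄ U)
  naturality {U V} i := ModuleCat.MonoidalCategory.tensor_ext (fun m n => hmap U V i m n)

end TensorDesc

section Tensor
variable {X T : Scheme.{0}} {h : T ⟶ X} {N₁ N₂ : X.Modules}

/-- The section of the tensor product given by a section of the presheaf tensor product. -/
def toTensor (N₁ N₂ : X.Modules) (U : X.Opens) :
    TensorProduct Γ(X, U) Γ(N₁, U) Γ(N₂, U) →+ Γ(tensor N₁ N₂, U) :=
  ((CategoryTheory.toSheafify (Opens.grothendieckTopology X)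
    (PresheafOfModules.Monoidal.tensorObj (R := X.presheaf) N₁.val N₂.val).presheaf).app
      (.op U)).hom

theorem exists_toTensor_eq {U : X.Opens} (σ : Γ(tensor N₁ N₂, U)) {x : X} (hx : x ∈ U) :
    ∃ (V : X.Opens) (h : V ≤ U) (τ : TensorProduct Γ(X, V) Γ(N₁, V) Γ(N₂, V)), x ∈ V ∧
      toTensor N₁ N₂ V τ = (tensor N₁ N₂).presheaf.map (homOfLE h).op σ := by
  have h1 := Presheaf.isLocallySurjective_toSheafify' (Opens.grothendieckTopology X)
    (PresheafOfModules.Monoidal.tensorObj (R := X.presheaf) N₁.val N₂.val).presheaf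
  have h2 := Presheaf.imageSieve_mem (Opens.grothendieckTopology X)
    (CategoryTheory.toSheafify (Opens.grothendieckTopology X)
    (PresheafOfModules.Monoidal.tensorObj (R := X.presheaf) N₁.val N₂.val).presheaf)
    (U := .op U) σ
  obtain ⟨V, i, ⟨τ, hτ⟩, hxV⟩ := h2 x hx
  exact ⟨V, leOfHom i, τ, hxV, hτ⟩

/-- The product of two morphisms to the direct image of the structure sheaf, on the presheaf tensor
product. -/
def mulPresheafHom (α : N₁ ⟶ pushUnit h) (β : N₂ ⟶ pushUnit h) :
    PresheafOfModules.Monoidal.tensorObj (R := X.presheaf) N₁.val N₂.val ⟶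
      (PresheafOfModules.restrictScalars (𝟙 X.ringCatSheaf.obj)).obj
        ((SheafOfModules.forget _).obj (pushUnit h)) :=
  presheafTensorDesc (R := X.presheaf) (N₁ := N₁.val) (N₂ := N₂.val)
    (G := (PresheafOfModules.restrictScalars (𝟙 X.ringCatSheaf.obj)).obj
      ((SheafOfModules.forget _).obj (pushUnit h)))
    (fun U (m : Γ(N₁, U.unop)) (n : Γ(N₂, U.unop)) => (pushUnitEquiv h U.unop).symm
      (pushUnitEquiv h U.unop (α.app U.unop m) * pushUnitEquiv h U.unop (β.app U.unop n)))
    (fun U (m m' : Γ(N₁, U.unop)) (n : Γ(N₂, U.unop)) => by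
      refine Eq.trans ?_ (map_add (pushUnitEquiv h U.unop).symm _ _)
      rw [← add_mul, ← map_add (pushUnitEquiv h U.unop), ← map_add]
      rfl)
    (fun U (r : Γ(X, U.unop)) (m : Γ(N₁, U.unop)) (n : Γ(N₂, U.unop)) => by
      apply (pushUnitEquiv h U.unop).injective
      refine Eq.trans ?_ (pushUnitEquiv_smul h U.unop r _).symm
      have h1 := α.app_smul r m
      refine Eq.trans ?_ (mul_assoc _ _ _)
      refine congrArg (· * pushUnitEquiv h U.unop (β.app U.unop n)) ?_
      exact (congrArg (pushUnitEquiv h U.unop) h1).trans (pushUnitEquiv_smul h U.unop r _))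
    (fun U (m : Γ(N₁, U.unop)) (n n' : Γ(N₂, U.unop)) => by
      refine Eq.trans ?_ (map_add (pushUnitEquiv h U.unop).symm _ _)
      rw [← mul_add, ← map_add (pushUnitEquiv h U.unop), ← map_add]
      rfl)
    (fun U (r : Γ(X, U.unop)) (m : Γ(N₁, U.unop)) (n : Γ(N₂, U.unop)) => by
      apply (pushUnitEquiv h U.unop).injective
      refine Eq.trans ?_ (pushUnitEquiv_smul h U.unop r _).symm
      have h1 := β.app_smul r n
      refine Eq.trans ?_ (mul_left_comm _ _ _)
      refine congrArg (pushUnitEquiv h U.unop (α.app U.unop m) * ·) ?_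
      exact (congrArg (pushUnitEquiv h U.unop) h1).trans (pushUnitEquiv_smul h U.unop r _))
    (fun U V i (m : Γ(N₁, U.unop)) (n : Γ(N₂, U.unop)) => by
      apply (pushUnitEquiv h V.unop).injective
      refine Eq.trans ?_ (pushUnitEquiv_map h (leOfHom i.unop) _).symm
      refine Eq.trans ?_ (map_mul (T.presheaf.map (homOfLE _).op).hom _ _).symm
      refine congrArg₂ (fun x y : Γ(T, h ⁻¹ᵁ V.unop) => x * y) ?_ ?_
      · exact congrArg (pushUnitEquiv h V.unop) (hom_app_map α (leOfHom i.unop) m)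
      · exact congrArg (pushUnitEquiv h V.unop) (hom_app_map β (leOfHom i.unop) n))

/-- The product of two morphisms to the direct image of the structure sheaf. -/
def mulHom (α : N₁ ⟶ pushUnit h) (β : N₂ ⟶ pushUnit h) : tensor N₁ N₂ ⟶ pushUnit h :=
  (PresheafOfModules.sheafificationHomEquiv (𝟙 X.ringCatSheaf.obj)
    (P := PresheafOfModules.Monoidal.tensorObj (R := X.presheaf) N₁.val N₂.val)
    (F := pushUnit h)).symm (mulPresheafHom α β)

theorem mulHom_app_toTensor (α : N₁ ⟶ pushUnit h) (β : N₂ ⟶ pushUnit h) (U : X.Opens)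
    (m : Γ(N₁, U)) (n : Γ(N₂, U)) :
    pushUnitEquiv h U ((mulHom α β).app U (toTensor N₁ N₂ U (m ⊗ₜ n))) =
      pushUnitEquiv h U (α.app U m) * pushUnitEquiv h U (β.app U n) := by
  have h0 : PresheafOfModules.sheafificationHomEquiv (𝟙 X.ringCatSheaf.obj) (mulHom α β) =
      mulPresheafHom α β := Equiv.apply_symm_apply _ _
  have h1 := (congrArg (PresheafOfModules.toPresheaf _).map h0).symm.trans
    (PresheafOfModules.toPresheaf_map_sheafificationHomEquiv_def (𝟙 X.ringCatSheaf.obj)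
      (mulHom α β))
  exact congr(($h1).app (.op U) (m ⊗ₜ[Γ(X, U)] n)).symm

end Tensor

/-! ### Rational functions as sections at the generic point -/

section Value

variable {C X : Scheme.{0}} [IsIntegral C] (f : C ⟶ X)

/-- The morphism from the spectrum of the function field of an integral scheme. -/
abbrev genTo : Spec C.functionField ⟶ X := C.fromSpecStalk (genericPoint C) ≫ f

theorem map_genericPoint_mem {U : X.Opens} {z : C} (hz : f z ∈ U) : f (genericPoint C) ∈ U :=
  ((genericPoint_specializes z).map f.continuous).mem_open U.isOpen hz

variable {f} in
theorem genTo_apply (x : Spec C.functionField) : genTo f x = f (genericPoint C) := by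
  have h1 : C.fromSpecStalk (genericPoint C) x ∈
      Set.range (C.fromSpecStalk (genericPoint C)) := ⟨x, rfl⟩
  rw [Scheme.range_fromSpecStalk] at h1
  have h2 : C.fromSpecStalk (genericPoint C) x = genericPoint C :=
    (h1.antisymm (genericPoint_specializes _)).eq
  exact congrArg f h2

variable {f} in
theorem top_le_genTo {U : X.Opens} (hU : f (genericPoint C) ∈ U) : ⊤ ≤ genTo f ⁻¹ᵁ U := by
  intro x _
  change genTo f x ∈ U
  rw [genTo_apply]
  exact hU

/-- Sections of the structure sheaf of the spectrum of the function field. -/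
def specSectionEquiv {O : (Spec C.functionField).Opens} (hO : ⊤ ≤ O) :
    Γ(Spec C.functionField, O) →+* C.functionField :=
  ((Spec C.functionField).presheaf.map (homOfLE hO).op ≫
    (Scheme.ΓSpecIso C.functionField).hom).hom

theorem specSectionEquiv_injective {O : (Spec C.functionField).Opens} (hO : ⊤ ≤ O) :
    Function.Injective (specSectionEquiv hO) := by
  obtain rfl : O = ⊤ := top_le_iff.mp hO
  have h1 : (homOfLE hO).op = 𝟙 (Opposite.op (⊤ : (Spec C.functionField).Opens)) := rfl
  rw [specSectionEquiv, h1, CategoryTheory.Functor.map_id, Category.id_comp]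
  exact (Scheme.ΓSpecIso C.functionField).commRingCatIsoToRingEquiv.injective

theorem specSectionEquiv_map {O O' : (Spec C.functionField).Opens} (hO : ⊤ ≤ O) (h : O' ≤ O)
    (hO' : ⊤ ≤ O') (s : Γ(Spec C.functionField, O)) :
    specSectionEquiv hO' ((Spec C.functionField).presheaf.map (homOfLE h).op s) =
      specSectionEquiv hO s := by
  have h1 := (Spec C.functionField).presheaf.map_comp (homOfLE h).op (homOfLE hO').op
  exact congr((Scheme.ΓSpecIso C.functionField).hom ($h1 s)).symm

theorem specSectionEquiv_fromSpecStalk_app {V : C.Opens} (hV : genericPoint C ∈ V)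
    (h : ⊤ ≤ C.fromSpecStalk (genericPoint C) ⁻¹ᵁ V) (a : Γ(C, V)) :
    specSectionEquiv h ((C.fromSpecStalk (genericPoint C)).app V a) =
      C.presheaf.germ V (genericPoint C) hV a := by
  have h1 : (C.fromSpecStalk (genericPoint C)).app V ≫ (Spec C.functionField).presheaf.map
      (homOfLE h).op ≫ (Scheme.ΓSpecIso C.functionField).hom =
      C.presheaf.germ V (genericPoint C) hV := by
    have h2 : (Spec C.functionField).presheaf.map (homOfLE le_top).op ≫
        (Spec C.functionField).presheaf.map (homOfLE h).op = 𝟙 _ := by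
      rw [← Functor.map_comp]
      exact CategoryTheory.Functor.map_id _ _
    rw [Scheme.fromSpecStalk_app hV, Category.assoc, Category.assoc, reassoc_of% h2]
    simp
  exact congr(($h1).hom a)

theorem genTo_app {U : X.Opens} (a : Γ(X, U)) :
    (genTo f).app U a = (C.fromSpecStalk (genericPoint C)).app (f ⁻¹ᵁ U) (f.app U a) := by
  rw [Scheme.Hom.comp_app]
  rfl

variable {f} in
theorem top_le_fromSpecStalk {U : X.Opens} (hU : f (genericPoint C) ∈ U) :
    ⊤ ≤ C.fromSpecStalk (genericPoint C) ⁻¹ᵁ f ⁻¹ᵁ U := by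
  have h1 := top_le_genTo hU
  rw [Scheme.Hom.comp_preimage] at h1
  exact h1

theorem specSectionEquiv_app {U : X.Opens} (hU : f (genericPoint C) ∈ U) (a : Γ(X, U)) :
    specSectionEquiv (top_le_genTo hU) ((genTo f).app U a) =
      C.presheaf.germ (f ⁻¹ᵁ U) (genericPoint C) hU (f.app U a) :=
  (congrArg (specSectionEquiv (top_le_genTo hU)) (genTo_app f a)).trans
    (specSectionEquiv_fromSpecStalk_app (V := f ⁻¹ᵁ U) hU (top_le_fromSpecStalk hU) (f.app U a))

variable {f} {N N₁ N₂ : X.Modules}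

/-- The rational function given by a section of a module with a morphism to the direct image of
the function field. -/
def value (α : N ⟶ pushUnit (genTo f)) {U : X.Opens} (hU : f (genericPoint C) ∈ U) :
    Γ(N, U) →+ C.functionField :=
  ((specSectionEquiv (top_le_genTo hU)).toAddMonoidHom.comp
    (pushUnitEquiv (genTo f) U).toAddMonoidHom).comp (α.app U).hom

theorem value_eq (α : N ⟶ pushUnit (genTo f)) {U : X.Opens} (hU : f (genericPoint C) ∈ U)
    (n : Γ(N, U)) : value α hU n =
      specSectionEquiv (top_le_genTo hU) (pushUnitEquiv (genTo f) U (α.app U n)) := rfl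

theorem value_smul (α : N ⟶ pushUnit (genTo f)) {U : X.Opens} (hU : f (genericPoint C) ∈ U)
    (a : Γ(X, U)) (n : Γ(N, U)) : value α hU (a • n) =
      C.presheaf.germ (f ⁻¹ᵁ U) (genericPoint C) hU (f.app U a) * value α hU n := by
  rw [value_eq, Scheme.Modules.Hom.app_smul, pushUnitEquiv_smul, map_mul, specSectionEquiv_app]
  rfl

theorem value_map (α : N ⟶ pushUnit (genTo f)) {U V : X.Opens} (hU : f (genericPoint C) ∈ U)
    (h : V ≤ U) (hV : f (genericPoint C) ∈ V) (n : Γ(N, U)) :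
    value α hV (N.presheaf.map (homOfLE h).op n) = value α hU n := by
  rw [value_eq, hom_app_map, pushUnitEquiv_map, specSectionEquiv_map]
  rfl

/-- Over an open set missing the image of the generic point the target has no nonzero sections; over
any other open set its sections embed in the function field. -/
theorem exists_value_ne_zero {α : N ⟶ pushUnit (genTo f)} (hα : α ≠ 0) :
    ∃ (U : X.Opens) (hU : f (genericPoint C) ∈ U) (n : Γ(N, U)), value α hU n ≠ 0 := by
  by_contra! h
  apply hα
  ext U n
  apply (pushUnitEquiv (genTo f) U).injective
  by_cases hU : f (genericPoint C) ∈ U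
  · apply specSectionEquiv_injective (top_le_genTo hU)
    refine (h U hU n).trans ?_
    exact (map_zero (value α hU)).symm.trans (by rw [value_eq, map_zero]; rfl)
  · have h1 : genTo f ⁻¹ᵁ U = ⊥ := by
      refine le_bot_iff.mp fun x hx => hU ?_
      rw [← genTo_apply x]
      exact hx
    have : Subsingleton Γ(Spec C.functionField, genTo f ⁻¹ᵁ U) := by
      rw [h1]
      infer_instance
    exact Subsingleton.elim _ _

theorem ne_zero_of_value_ne_zero {α : N ⟶ pushUnit (genTo f)} {U : X.Opens}
    {hU : f (genericPoint C) ∈ U} {n : Γ(N, U)} (h : value α hU n ≠ 0) : α ≠ 0 := by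
  rintro rfl
  exact h ((value_eq _ _ _).trans (by
    rw [Scheme.Modules.Hom.zero_app]
    exact (map_zero (specSectionEquiv (top_le_genTo hU)))))

theorem value_toTensor (α : N₁ ⟶ pushUnit (genTo f)) (β : N₂ ⟶ pushUnit (genTo f)) {U : X.Opens}
    (hU : f (genericPoint C) ∈ U) (m : Γ(N₁, U)) (n : Γ(N₂, U)) :
    value (mulHom α β) hU (toTensor N₁ N₂ U (m ⊗ₜ n)) = value α hU m * value β hU n := by
  rw [value_eq, mulHom_app_toTensor, map_mul]
  rfl

theorem mulHom_ne_zero {α : N₁ ⟶ pushUnit (genTo f)} {β : N₂ ⟶ pushUnit (genTo f)} (hα : α ≠ 0)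
    (hβ : β ≠ 0) : mulHom α β ≠ 0 := by
  obtain ⟨U, hU, m, hm⟩ := exists_value_ne_zero hα
  obtain ⟨V, hV, n, hn⟩ := exists_value_ne_zero hβ
  have hUV : f (genericPoint C) ∈ U ⊓ V := ⟨hU, hV⟩
  refine ne_zero_of_value_ne_zero (hU := hUV) (n := toTensor N₁ N₂ _
    (N₁.presheaf.map (homOfLE inf_le_left).op m ⊗ₜ N₂.presheaf.map (homOfLE inf_le_right).op n)) ?_
  rw [value_toTensor, value_map _ hU, value_map _ hV]
  exact mul_ne_zero hm hn

/-- The values of the sections near `z` lie in `S`. -/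
def IsBoundedAt (α : N ⟶ pushUnit (genTo f)) (z : C)
    (S : Submodule (C.presheaf.stalk z) C.functionField) : Prop :=
  ∀ (U : X.Opens) (hU : f z ∈ U) (n : Γ(N, U)), value α (map_genericPoint_mem f hU) n ∈ S

/-- Values do not change under restriction, and near `f z` a section of the sheafified tensor
product is a sum of pure tensors. -/
theorem IsBoundedAt.mulHom {α : N₁ ⟶ pushUnit (genTo f)} {β : N₂ ⟶ pushUnit (genTo f)} {z : C}
    {S S' : Submodule (C.presheaf.stalk z) C.functionField} (hα : IsBoundedAt α z S)
    (hβ : IsBoundedAt β z S') : IsBoundedAt (mulHom α β) z (S * S') := by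
  intro U hU σ
  obtain ⟨V, hVU, τ, hV, hτ⟩ := exists_toTensor_eq σ hU
  rw [← value_map _ (map_genericPoint_mem f hU) hVU (map_genericPoint_mem f hV), ← hτ]
  clear hτ
  induction τ with
  | zero => simp
  | add x y hx hy =>
    rw [map_add, map_add]
    exact Submodule.add_mem _ hx hy
  | tmul m n =>
    rw [value_toTensor]
    exact Submodule.mul_mem_mul (hα V hV m) (hβ V hV n)

theorem isBoundedAt_of_generator (α : N ⟶ pushUnit (genTo f)) {z : C} {V : X.Opens} (hV : f z ∈ V)
    {e : Γ(N, V)} (he : IsFrame N V e) :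
    IsBoundedAt α z (Submodule.span _ {value α (map_genericPoint_mem f hV) e}) := by
  intro U hU n
  have hW : f z ∈ U ⊓ V := ⟨hU, hV⟩
  rw [← value_map α _ inf_le_left (map_genericPoint_mem f hW),
    ← he.coord_smul inf_le_right (N.presheaf.map (homOfLE inf_le_left).op n), value_smul,
    value_map α (map_genericPoint_mem f hV)]
  refine Submodule.mem_span_singleton.mpr ⟨C.presheaf.germ (f ⁻¹ᵁ (U ⊓ V)) z hW
    (f.app (U ⊓ V) (he.coord inf_le_right (N.presheaf.map (homOfLE inf_le_left).op n))), ?_⟩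
  rw [Algebra.smul_def]
  exact congrArg (· * _) (algebraMap_germ_eq (U := f ⁻¹ᵁ (U ⊓ V)) hW
    (map_genericPoint_mem f hW) _)

end Value

/-! ### Tensor powers -/

section Power

variable {C X T : Scheme.{0}} [IsIntegral C] {f : C ⟶ X}

/-- The canonical morphism to the direct image of the structure sheaf. -/
def unitToPushUnit (h : T ⟶ X) : (SheafOfModules.unit X.ringCatSheaf : X.Modules) ⟶ pushUnit h :=
  modHomMk (fun U => (pushUnitEquiv h U).symm.toAddMonoidHom.comp (h.app U).hom.toAddMonoidHom)
    (fun U V i m => by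
      apply (pushUnitEquiv h V).injective
      exact congr($(h.naturality (homOfLE i).op) m))
    (fun U r m => by
      apply (pushUnitEquiv h U).injective
      refine Eq.trans ?_ (pushUnitEquiv_smul h U r _).symm
      exact map_mul (h.app U).hom r m)

theorem value_unitToPushUnit {U : X.Opens} (hU : f (genericPoint C) ∈ U) (a : Γ(X, U)) :
    value (unitToPushUnit (genTo f)) hU a =
      C.presheaf.germ (f ⁻¹ᵁ U) (genericPoint C) hU (f.app U a) :=
  specSectionEquiv_app f hU a

/-- The powers of a morphism to the direct image of the structure sheaf. -/
def powHom {h : T ⟶ X} {E : X.Modules} (α : E ⟶ pushUnit h) : ∀ s, tensorPow E s ⟶ pushUnit h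
  | 0 => unitToPushUnit h
  | s + 1 => mulHom (powHom α s) α

theorem powHom_ne_zero {E : X.Modules} {α : E ⟶ pushUnit (genTo f)} (hα : α ≠ 0) (s : ℕ) :
    powHom α s ≠ 0 := by
  induction s with
  | zero =>
    refine ne_zero_of_value_ne_zero (U := ⊤) (hU := trivial) (n := (1 : Γ(X, ⊤))) ?_
    refine (value_unitToPushUnit (U := ⊤) trivial 1).trans_ne ?_
    rw [map_one, map_one]
    exact one_ne_zero
  | succ s ih => exact mulHom_ne_zero ih hα

theorem isBoundedAt_powHom {E : X.Modules} {α : E ⟶ pushUnit (genTo f)} {z : C}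
    {b : C.functionField} (hα : IsBoundedAt α z (Submodule.span _ {b})) (s : ℕ) :
    IsBoundedAt (powHom α s) z (Submodule.span _ {b ^ s}) := by
  induction s with
  | zero =>
    intro U hU n
    rw [pow_zero]
    refine Submodule.mem_span_singleton.mpr ⟨C.presheaf.germ (f ⁻¹ᵁ U) z hU (f.app U n), ?_⟩
    rw [Algebra.smul_def, mul_one, algebraMap_germ_eq (U := f ⁻¹ᵁ U) hU (map_genericPoint_mem f hU)]
    exact (value_unitToPushUnit (map_genericPoint_mem f hU) n).symm
  | succ s ih =>
    have h1 := ih.mulHom hα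
    rw [Submodule.span_mul_span, Set.singleton_mul_singleton, ← pow_succ] at h1
    exact h1

end Power

/-! ### Frames of line bundles -/

section LineBundle

variable {X T : Scheme.{0}}

/-- The structure sheaf as a module over itself. -/
abbrev structureModule (T : Scheme.{0}) : T.Modules := SheafOfModules.unit T.ringCatSheaf

theorem isFrame_of_iso_unit {N : T.Modules} (θ : N ≅ structureModule T) :
    IsFrame N ⊤ (θ.inv.app ⊤ (1 : Γ(T, ⊤))) := by
  intro W hW
  have h1 : (fun a : Γ(T, W) => a • (N.presheaf.map (homOfLE hW).op
      (θ.inv.app ⊤ (1 : Γ(T, ⊤))) : Γ(N, W))) = fun a : Γ(T, W) => θ.inv.app W a := by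
    funext a
    have h2 : (structureModule T).presheaf.map (homOfLE hW).op
        (1 : Γ(T, ⊤)) = (1 : Γ(T, W)) := map_one (T.presheaf.map (homOfLE hW).op).hom
    refine (congrArg (fun m : Γ(N, W) => a • m) (hom_app_map θ.inv hW (1 : Γ(T, ⊤)))).symm.trans ?_
    refine (congrArg (fun m => a • θ.inv.app W m) h2).trans ?_
    refine (θ.inv.app_smul a _).symm.trans ?_
    exact congrArg (θ.inv.app W) (mul_one a)
  rw [h1]
  have h3 : IsIso θ.inv := Iso.isIso_inv θ
  have h4 : IsIso (θ.inv.app W) := Scheme.Modules.Hom.isIso_iff_isIso_app.mp h3 W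
  exact (CategoryTheory.ConcreteCategory.isIso_iff_bijective (θ.inv.app W)).mp h4

theorem isFrame_of_restrict (j : T ⟶ X) [IsOpenImmersion j] {M : X.Modules}
    {e : Γ(M.restrict j, ⊤)} (he : IsFrame (M.restrict j) ⊤ e) :
    IsFrame M (j ''ᵁ ⊤) (M.restrictAppIso j ⊤ |>.hom e) := by
  intro W hW
  obtain ⟨W', rfl⟩ : ∃ W', W = j ''ᵁ W' := by
    refine ⟨j ⁻¹ᵁ W, ?_⟩
    rw [Scheme.Hom.image_preimage_eq_opensRange_inf]
    rw [Scheme.Hom.image_top_eq_opensRange] at hW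
    exact (inf_eq_right.mpr hW).symm
  have h1 : Function.Bijective (j.appIso W').hom :=
    (CategoryTheory.ConcreteCategory.isIso_iff_bijective _).mp inferInstance
  have h2 := (he W' le_top).comp h1
  refine (congrArg Function.Bijective (funext fun a => ?_)).mpr h2
  exact congr($(Scheme.Modules.smul_restrictAppIso_inv j M W' a)
    (M.presheaf.map (homOfLE hW).op (M.restrictAppIso j ⊤ |>.hom e)))

theorem IsLineBundle.exists_isFrame {L : X.Modules} (hL : IsLineBundle L) (x : X) :
    ∃ (V : X.Opens) (e : Γ(L, V)), x ∈ V ∧ IsFrame L V e := by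
  obtain ⟨U, hx, ⟨θ⟩⟩ := hL x
  -- The free module on `Fin 1` is a coproduct with a single summand, the structure sheaf.
  let θ' : L.restrict U.ι ≅ structureModule U.toScheme :=
    θ ≪≫ Limits.coproductUniqueIso
      (fun _ : Fin 1 => structureModule U.toScheme)
  refine ⟨U.ι ''ᵁ ⊤, _, ?_, isFrame_of_restrict U.ι (isFrame_of_iso_unit θ')⟩
  rw [Scheme.Opens.ι_image_top]
  exact hx

end LineBundle

/-! ### Rational functions from line bundle quotients -/

section Quotient

variable {C X : Scheme.{0}} [IsIntegral C] {f : C ⟶ X}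

theorem IsFrame.value_toPushUnit {N : X.Modules} {V : X.Opens} {e : Γ(N, V)} (he : IsFrame N V e)
    (hV : f (genericPoint C) ∈ V) :
    value (he.toPushUnit (genTo f) (top_le_genTo hV)) hV e = 1 := by
  rw [value_eq, he.toPushUnit_self, map_one]

theorem IsFrame.toPushUnit_ne_zero {N : X.Modules} {V : X.Opens} {e : Γ(N, V)} (he : IsFrame N V e)
    (hV : f (genericPoint C) ∈ V) : he.toPushUnit (genTo f) (top_le_genTo hV) ≠ 0 := by
  refine ne_zero_of_value_ne_zero (hU := hV) (n := e) ?_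
  rw [he.value_toPushUnit hV]
  exact one_ne_zero

variable {E : X.Modules} {M : C.Modules}

variable (f) in
theorem genTo_id_comp : genTo (𝟙 C) ≫ f = genTo f := by
  rw [genTo, Category.comp_id]

/-- The identification of the direct image of the function field. -/
def pushUnitGenToIso (f : C ⟶ X) :
    (Scheme.Modules.pushforward f).obj (pushUnit (genTo (𝟙 C))) ≅ pushUnit (genTo f) :=
  (Scheme.Modules.pushforwardComp (genTo (𝟙 C)) f).app _ ≪≫
    (Scheme.Modules.pushforwardCongr (genTo_id_comp f)).app _

/-- The morphism to the direct image of the function field induced by a morphism from a pullback. -/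
def quotientHom (u : (Scheme.Modules.pullback f).obj E ⟶ M) (φ : M ⟶ pushUnit (genTo (𝟙 C))) :
    E ⟶ pushUnit (genTo f) :=
  (Scheme.Modules.pullbackPushforwardAdjunction f).homEquiv _ _ (u ≫ φ) ≫
    (pushUnitGenToIso f).hom

/-- Surjectivity of the quotient enters here: `u ≫ φ` vanishes only if `φ` does, and adjunction
preserves this. -/
theorem quotientHom_ne_zero (u : (Scheme.Modules.pullback f).obj E ⟶ M) [Epi u]
    {φ : M ⟶ pushUnit (genTo (𝟙 C))} (hφ : φ ≠ 0) : quotientHom u φ ≠ 0 := by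
  intro h
  have h1 : (Scheme.Modules.pullbackPushforwardAdjunction f).homEquiv _ _ (u ≫ φ) = 0 := by
    rw [← cancel_mono (pushUnitGenToIso f).hom]
    exact h.trans Limits.zero_comp.symm
  have h2 : (Scheme.Modules.pullbackPushforwardAdjunction f).homEquiv E (pushUnit (genTo (𝟙 C))) 0
      = 0 := by
    rw [Adjunction.homEquiv_unit, Functor.map_zero, Limits.comp_zero]
  have h3 := (Equiv.injective _) (h1.trans h2.symm)
  exact hφ (by rwa [← cancel_epi u, Limits.comp_zero])

theorem value_quotientHom (u : (Scheme.Modules.pullback f).obj E ⟶ M)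
    (φ : M ⟶ pushUnit (genTo (𝟙 C))) {U : X.Opens} (hU : f (genericPoint C) ∈ U) (n : Γ(E, U)) :
    value (quotientHom u φ) hU n = value φ (U := f ⁻¹ᵁ U) hU
      (((Scheme.Modules.pullbackPushforwardAdjunction f).homEquiv _ _ u).app U n) := by
  rw [quotientHom, Adjunction.homEquiv_naturality_right]
  refine (value_eq _ _ _).trans (Eq.trans ?_ (value_eq φ (U := f ⁻¹ᵁ U) hU _).symm)
  exact specSectionEquiv_map _ _ _ _

theorem isBoundedAt_quotientHom (u : (Scheme.Modules.pullback f).obj E ⟶ M)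
    {φ : M ⟶ pushUnit (genTo (𝟙 C))} {z : C} {S : Submodule (C.presheaf.stalk z) C.functionField}
    (h : IsBoundedAt φ z S) : IsBoundedAt (quotientHom u φ) z S := by
  intro U hU n
  rw [value_quotientHom]
  exact h (f ⁻¹ᵁ U) hU _

end Quotient

/-! ### Global generation -/

section Generated

variable {X : Scheme.{0}}

/-- A morphism that kills all global sections agrees with zero on a generating family, hence after
composition with an epimorphism from a free module. -/
theorem IsGloballyGenerated.exists_app_ne_zero {N G : X.Modules} (hN : IsGloballyGenerated N)
    {α : N ⟶ G} (hα : α ≠ 0) : ∃ n : Γ(N, ⊤), α.app ⊤ n ≠ 0 := by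
  obtain ⟨σ⟩ := hN
  by_contra! h
  apply hα
  have h0 : Epi σ.π := σ.epi
  have h1 (i : σ.I) : SheafOfModules.sectionsMap α (σ.s i) =
      SheafOfModules.sectionsMap (0 : N ⟶ G) (σ.s i) := by
    refine PresheafOfModules.sections_ext _ _ fun U => ?_
    obtain ⟨n, hn⟩ : ∃ n : Γ(N, ⊤),
        N.presheaf.map (homOfLE (le_top : U.unop ≤ ⊤)).op n = (σ.s i).val U :=
      ⟨(σ.s i).val (.op ⊤), (σ.s i).2 (homOfLE le_top).op⟩
    have h2 : α.app U.unop ((σ.s i).val U) = 0 := by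
      rw [← hn, hom_app_map, h, map_zero]
    exact h2
  refine (cancel_epi (C := SheafOfModules X.ringCatSheaf) σ.π).mp ?_
  refine (SheafOfModules.freeHomEquiv_symm_comp σ.s α).trans (Eq.trans ?_
    (SheafOfModules.freeHomEquiv_symm_comp σ.s (0 : N ⟶ G)).symm)
  exact congrArg _ (funext h1)

end Generated

/-! ### Orders of rational sections -/

section Order

variable {C : Scheme.{0}} [IsIntegral C] {M : C.Modules}

theorem value_smul_id (φ : M ⟶ pushUnit (genTo (𝟙 C))) {U : C.Opens} (hU : genericPoint C ∈ U)
    (a : Γ(C, U)) (m : Γ(M, U)) : value φ (U := U) hU (a • m) =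
      C.presheaf.germ U (genericPoint C) hU a * value φ (U := U) hU m := by
  refine (value_smul φ hU a m).trans ?_
  simp only [Scheme.Hom.id_app]
  rfl

theorem genericPoint_mem_of_mem {U : C.Opens} {z : C} (hz : z ∈ U) : genericPoint C ∈ U :=
  (genericPoint_specializes z).mem_open U.isOpen hz

theorem IsFrame.value_ne_zero {V₀ V : C.Opens} {e₀ : Γ(M, V₀)} (he₀ : IsFrame M V₀ e₀)
    (h₀ : genericPoint C ∈ V₀) {e : Γ(M, V)} (he : IsFrame M V e) (hV : genericPoint C ∈ V) :
    value (he₀.toPushUnit (genTo (𝟙 C)) (top_le_genTo (U := V₀) h₀)) (U := V) hV e ≠ 0 := by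
  intro h
  set φ := he₀.toPushUnit (genTo (𝟙 C)) (top_le_genTo (U := V₀) h₀)
  have hW : genericPoint C ∈ V ⊓ V₀ := ⟨hV, h₀⟩
  have h1 : value φ (U := V ⊓ V₀) hW (M.presheaf.map (homOfLE inf_le_right).op e₀) = 1 :=
    (value_map φ (U := V₀) h₀ inf_le_right (V := V ⊓ V₀) hW e₀).trans (he₀.value_toPushUnit h₀)
  have h2 : value φ (U := V ⊓ V₀) hW (M.presheaf.map (homOfLE inf_le_left).op e) = 0 :=
    (value_map φ (U := V) hV inf_le_left (V := V ⊓ V₀) hW e).trans h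
  rw [← he.coord_smul (inf_le_left : V ⊓ V₀ ≤ V) (M.presheaf.map (homOfLE inf_le_right).op e₀),
    value_smul_id, h2, mul_zero] at h1
  exact zero_ne_one h1

/-- Passing to values is injective: locally `t` is a multiple `a • e` of a frame, the value of `e`
is nonzero, and `a` is determined by its germ at the generic point. -/
theorem IsFrame.value_ne_zero_of_ne_zero {V₀ : C.Opens} {e₀ : Γ(M, V₀)} (he₀ : IsFrame M V₀ e₀)
    (h₀ : genericPoint C ∈ V₀)
    (hM : ∀ z : C, ∃ (V : C.Opens) (e : Γ(M, V)), z ∈ V ∧ IsFrame M V e)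
    {U : C.Opens} (hU : genericPoint C ∈ U) {t : Γ(M, U)} (ht : t ≠ 0) :
    value (he₀.toPushUnit (genTo (𝟙 C)) (top_le_genTo (U := V₀) h₀)) (U := U) hU t ≠ 0 := by
  intro h
  apply ht
  choose V e hV he using hM
  refine TopCat.Sheaf.eq_of_locally_eq' ⟨M.presheaf, M.isSheaf⟩ (fun z : U => U ⊓ V z) U
    (fun z => homOfLE inf_le_left) (fun z hz => ?_) t 0 fun z => ?_
  · exact Opens.mem_iSup.mpr ⟨⟨z, hz⟩, hz, hV z⟩
  · refine Eq.trans ?_ (map_zero (M.presheaf.map (homOfLE inf_le_left).op).hom).symm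
    change M.presheaf.map (homOfLE (inf_le_left : U ⊓ V z ≤ U)).op t = 0
    have hW : genericPoint C ∈ U ⊓ V z := ⟨hU, genericPoint_mem_of_mem (hV z)⟩
    have h1 := value_map (he₀.toPushUnit (genTo (𝟙 C)) (top_le_genTo (U := V₀) h₀)) (U := U) hU
      inf_le_left (V := U ⊓ V z) hW t
    rw [← (he z).coord_smul inf_le_right (M.presheaf.map (homOfLE inf_le_left).op t)] at h1 ⊢
    rw [value_smul_id _ hW] at h1
    have h2 := value_map (he₀.toPushUnit (genTo (𝟙 C)) (top_le_genTo (U := V₀) h₀)) (U := V z)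
      hW.2 inf_le_right (V := U ⊓ V z) hW (e z)
    rw [h2] at h1
    have h3 := (mul_eq_zero.mp (h1.trans h)).resolve_right (he₀.value_ne_zero h₀ (he z) hW.2)
    rw [← map_zero (C.presheaf.germ (U ⊓ V z) (genericPoint C) hW).hom] at h3
    rw [germ_injective_of_isIntegral C _ hW h3, zero_smul]

theorem HasOrderAt.exists_isFrame [IsLocallyNoetherian C] {U : C.Opens} {t : Γ(M, U)} {z : C}
    {n : ℤ} (h : HasOrderAt M t z n) : ∃ (V : C.Opens) (e : Γ(M, V)), z ∈ V ∧ IsFrame M V e := by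
  obtain ⟨V, -, -, -, -, e, -, hz, he, -⟩ := h
  exact ⟨V, e, hz, he⟩

/-- The function `b` is the value of the frame `e` in which the order is measured; applying `φ` to
`t = a • e` gives the relation between the orders. -/
theorem HasOrderAt.ord_value [IsLocallyNoetherian C] {U : C.Opens} {t : Γ(M, U)} {z : C}
    {n : ℤ} (h : HasOrderAt M t z n) (hU : genericPoint C ∈ U) (φ : M ⟶ pushUnit (genTo (𝟙 C)))
    (ht : value φ (U := U) hU t ≠ 0) :
    ∃ b : C.functionField, b ≠ 0 ∧ IsBoundedAt φ z (Submodule.span _ {b}) ∧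
      Scheme.ord (value φ (U := U) hU t) z = n + Scheme.ord b z := by
  obtain ⟨V, W, hW0, hWU, hWV, e, a, hz, he, hte, ha⟩ := h
  have hW : genericPoint C ∈ W := genericPoint_mem W
  have hV : genericPoint C ∈ V := genericPoint_mem_of_mem hz
  have h1 := congrArg (value φ (U := W) hW) hte
  rw [value_smul_id] at h1
  have h2 := value_map φ (U := V) hV hWV (V := W) hW e
  have h3 := value_map φ (U := U) hU hWU (V := W) hW t
  rw [h2, h3] at h1
  rw [h1] at ht
  refine ⟨value φ (U := V) hV e, right_ne_zero_of_mul ht, ?_, ?_⟩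
  · exact isBoundedAt_of_generator φ (V := V) hz he
  · rw [h1, Scheme.ord_mul (left_ne_zero_of_mul ht) (right_ne_zero_of_mul ht), ← ha]

theorem ord_pow [IsLocallyNoetherian C] {b : C.functionField} (hb : b ≠ 0) (z : C) (s : ℕ) :
    Scheme.ord (b ^ s) z = s * Scheme.ord b z := by
  induction s with
  | zero => rw [pow_zero, ord_one, Nat.cast_zero, zero_mul]
  | succ s ih =>
    rw [pow_succ, Scheme.ord_mul (pow_ne_zero s hb) hb, ih]
    push_cast
    ring

theorem ord_le_of_mem_span [IsLocallyNoetherian C] (hdim : topologicalKrullDim C = 1)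
    {a b : C.functionField} {z : C} (ha : a ≠ 0)
    (h : a ∈ Submodule.span (C.presheaf.stalk z) {b}) : Scheme.ord b z ≤ Scheme.ord a z := by
  obtain ⟨o, rfl⟩ := Submodule.mem_span_singleton.mp h
  have ho : o ≠ 0 := by
    rintro rfl
    exact ha (zero_smul _ b)
  have hb : b ≠ 0 := by
    rintro rfl
    exact ha (smul_zero o)
  have ho' : algebraMap _ C.functionField o ≠ 0 := by
    intro h
    apply ha
    rw [Algebra.smul_def, h, zero_mul]
  rw [Algebra.smul_def, Scheme.ord_mul ho' hb, ord_eq_ringOrd hdim z o ho]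
  linarith [Int.natCast_nonneg (Ring.ord (C.presheaf.stalk z) o).toNat]

end Order

/-! ### A bound for the poles of the sections of a line bundle -/

section Poles

variable {C X : Scheme.{0}} [IsIntegral C] {f : C ⟶ X}

theorem finite_support_of_finite {α β : Type*} (g : β → α → ℤ) (F : Finset β)
    (h : ∀ b, (Function.support (g b)).Finite) (y : α → β) (hy : ∀ z, y z ∈ F) :
    (Function.support fun z => g (y z) z).Finite :=
  (F.finite_toSet.biUnion fun w _ => h w).subset fun z hz => Set.mem_biUnion (hy z) hz

/-- By quasi-compactness finitely many functions `b` suffice, and each has finitely many zeros and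
poles. -/
theorem exists_finite_support_ord [IsLocallyNoetherian C] [NoetherianSpace C]
    (hdim : topologicalKrullDim C = 1) (P : C → C.functionField → Prop)
    (hP : ∀ y : C, ∃ (O : C.Opens) (b : C.functionField), y ∈ O ∧ ∀ z ∈ O, P z b) :
    ∃ c : C → C.functionField, (∀ z, P z (c z)) ∧
      (Function.support fun z => Scheme.ord (c z) z).Finite := by
  choose O b hO hb using hP
  obtain ⟨F, hF⟩ := CompactSpace.elim_nhds_subcover (fun z => (O z : Set C))
    fun z => (O z).isOpen.mem_nhds (hO z)
  have h1 (z : C) : ∃ y ∈ F, z ∈ O y := by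
    have h2 : z ∈ (⊤ : Set C) := trivial
    rw [← hF] at h2
    simpa using h2
  choose y hyF hy using h1
  have h2 (c : C.functionField) : (Function.support (Scheme.ord c)).Finite := by
    by_cases hc : c = 0
    · rw [hc, Scheme.ord_zero]
      simp
    · exact finite_support_ord hdim hc
  exact ⟨fun z => b (y z), fun z => hb _ z (hy z),
    finite_support_of_finite (fun w => Scheme.ord (b w)) F (fun w => h2 (b w)) y hyF⟩

/-- The functions `c z` are values of frames of `L`. The sum of their orders is the constant
contribution of `L`, the same for every tensor power of `E`; finite support makes it meaningful. -/
theorem IsLineBundle.exists_isBoundedAt [IsLocallyNoetherian C] [NoetherianSpace C]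
    (hdim : topologicalKrullDim C = 1) {L : X.Modules} (hL : IsLineBundle L) :
    ∃ (l : L ⟶ pushUnit (genTo f)) (c : C → C.functionField), l ≠ 0 ∧
      (∀ z, IsBoundedAt l z (Submodule.span _ {c z})) ∧
      (Function.support fun z => Scheme.ord (c z) z).Finite := by
  obtain ⟨V, e, hV, he⟩ := hL.exists_isFrame (f (genericPoint C))
  obtain ⟨l, hl⟩ : ∃ l : L ⟶ pushUnit (genTo f), l ≠ 0 := ⟨_, he.toPushUnit_ne_zero hV⟩
  refine ⟨l, ?_⟩
  obtain ⟨c, hc⟩ := exists_finite_support_ord hdim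
    (fun z c => IsBoundedAt l z (Submodule.span _ {c})) fun y => by
      obtain ⟨V, e, hV, he⟩ := hL.exists_isFrame (f y)
      exact ⟨f ⁻¹ᵁ V, value l (map_genericPoint_mem f hV) e, hV, fun z hz =>
        isBoundedAt_of_generator l hz he⟩
  exact ⟨c, hl, hc⟩

end Poles

/-! ### The degree of a quotient line bundle -/

section Degree

theorem nonneg_of_forall_le_mul {d c : ℤ} {s₀ : ℕ} (h : ∀ s : ℕ, s₀ ≤ s → c ≤ s * d) : 0 ≤ d := by
  by_contra! hd
  have h1 := h (s₀ + c.natAbs + 1) (by omega)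
  have h2 : -|c| ≤ c := neg_abs_le c
  push_cast at h1
  nlinarith [abs_nonneg c, Int.natCast_nonneg s₀]

theorem finsum_nonpos_of_nonpos {α : Type*} {g : α → ℤ} (h : ∀ z, g z ≤ 0) : ∑ᶠ z, g z ≤ 0 := by
  have h1 : 0 ≤ ∑ᶠ z, -g z := finsum_nonneg fun z => neg_nonneg.mpr (h z)
  rw [finsum_neg_distrib] at h1
  linarith

/-- If each `s : ℕ` large enough admits a nonzero rational function with poles bounded by `b ^ s * c`
then the orders of `b` have nonpositive sum. -/
theorem finsum_nonneg_of_forall_exists {C : Scheme.{0}} [IsIntegral C] [IsLocallyNoetherian C]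
    [NoetherianSpace C] {k : Type} [Field k] [IsAlgClosed k] (p : C ⟶ Spec (.of k)) [IsProper p]
    (hdim : topologicalKrullDim C = 1) {τ : C.functionField} (hτ : τ ≠ 0) {D o : C → ℤ}
    (ho : (Function.support o).Finite) {s₀ : ℕ}
    (h : ∀ s : ℕ, s₀ ≤ s → ∃ a : C.functionField, a ≠ 0 ∧
      ∀ z, s * (Scheme.ord τ z - D z) + o z ≤ Scheme.ord a z) : 0 ≤ ∑ᶠ z, D z := by
  by_cases hD : (Function.support D).Finite
  swap
  -- With infinite support the sum is zero by convention.
  · exact (finsum_of_infinite_support hD).ge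
  refine nonneg_of_forall_le_mul (c := ∑ᶠ z, o z) (s₀ := s₀) fun s hs => ?_
  obtain ⟨a, ha, hle⟩ := h s hs
  have hfτ := finite_support_ord hdim hτ
  have hfa := finite_support_ord hdim ha
  have h1 := finsum_nonpos_of_nonpos fun z => sub_nonpos.mpr (hle z)
  have hf1 : (Function.support fun z => Scheme.ord τ z - D z).Finite :=
    (hfτ.union hD).subset (Function.support_sub _ _)
  have hf2 : (Function.support fun z => (s : ℤ) * (Scheme.ord τ z - D z)).Finite :=
    hf1.subset (Function.support_mul_subset_right _ _)
  have hf3 : (Function.support fun z => (s : ℤ) * (Scheme.ord τ z - D z) + o z).Finite :=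
    (hf2.union ho).subset (Function.support_add _ _)
  -- As `τ` and `a` have degree zero, the summed inequality reads `s * (0 - ∑ D) + ∑ o ≤ 0`.
  rw [finsum_sub_distrib hf3 hfa, finsum_add_distrib hf2 ho, ← mul_finsum,
    finsum_sub_distrib hfτ hD, finsum_ord_eq_zero p hdim hτ, finsum_ord_eq_zero p hdim ha] at h1
  linarith

variable {C X : Scheme.{0}} [IsIntegral C] {f : C ⟶ X} {E L : X.Modules}

/-- The function `a` is the value under `α^s · l` of a global section that this nonzero morphism
does not kill. Being global, the section is subject to the local bounds at every point `z`. -/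
theorem exists_value_ne_zero_of_isGloballyGenerated {α : E ⟶ pushUnit (genTo f)}
    {l : L ⟶ pushUnit (genTo f)} (hα : α ≠ 0) (hl : l ≠ 0) {s : ℕ}
    (hgen : IsGloballyGenerated (tensor (tensorPow E s) L)) {b c : C → C.functionField}
    (hb : ∀ z, IsBoundedAt α z (Submodule.span _ {b z}))
    (hc : ∀ z, IsBoundedAt l z (Submodule.span _ {c z})) :
    ∃ a : C.functionField, a ≠ 0 ∧
      ∀ z, a ∈ Submodule.span (C.presheaf.stalk z) {b z ^ s * c z} := by
  obtain ⟨σ, hσ⟩ := hgen.exists_app_ne_zero (mulHom_ne_zero (powHom_ne_zero hα s) hl)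
  refine ⟨value (mulHom (powHom α s) l) (U := ⊤) trivial σ, fun h => hσ ?_, fun z => ?_⟩
  · apply (pushUnitEquiv (genTo f) ⊤).injective
    apply specSectionEquiv_injective (top_le_genTo (U := ⊤) trivial)
    rw [map_zero, map_zero]
    exact h
  · have h1 := (isBoundedAt_powHom (hb z) s).mulHom (hc z)
    rw [Submodule.span_mul_span, Set.singleton_mul_singleton] at h1
    exact h1 ⊤ trivial σ

theorem nonneg_of_hasDegree [IsLocallyNoetherian C] {k : Type} [Field k] [IsAlgClosed k]
    (p : C ⟶ Spec (.of k)) [IsProper p] (hdim : topologicalKrullDim C = 1) (hL : IsLineBundle L)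
    {s₀ : ℕ} (hgen : ∀ s, s₀ ≤ s → IsGloballyGenerated (tensor (tensorPow E s) L))
    {M : C.Modules} (u : (Scheme.Modules.pullback f).obj E ⟶ M) [Epi u] {d : ℤ}
    (hd : HasDegree M d) : 0 ≤ d := by
  have : CompactSpace C := compactSpace_of_quasiCompact p
  have : IsNoetherian C := { }
  obtain ⟨U, hU0, t, D, ht, hD, hD0, rfl⟩ := hd
  have hU : genericPoint C ∈ U := genericPoint_mem U
  have hfr (z : C) (hz : z ≠ genericPoint C) :
      ∃ (V : C.Opens) (e : Γ(M, V)), z ∈ V ∧ IsFrame M V e :=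
    (hD z ((coheight_eq_one_iff hdim z).mpr hz)).exists_isFrame
  -- The degree datum supplies frames only at points of codimension one; any such frame is also
  -- defined at the generic point.
  obtain ⟨V₀, e₀, h₀, he₀⟩ : ∃ (V : C.Opens) (e : Γ(M, V)), genericPoint C ∈ V ∧ IsFrame M V e := by
    obtain ⟨z, hz⟩ := exists_ne_genericPoint hdim
    obtain ⟨V, e, hzV, he⟩ := hfr z hz
    exact ⟨V, e, genericPoint_mem_of_mem hzV, he⟩
  have hfr' (z : C) : ∃ (V : C.Opens) (e : Γ(M, V)), z ∈ V ∧ IsFrame M V e := by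
    by_cases hz : z = genericPoint C
    · exact ⟨V₀, e₀, hz ▸ h₀, he₀⟩
    · exact hfr z hz
  obtain ⟨φ, hφ, hφ₀, hτ⟩ : ∃ φ : M ⟶ pushUnit (genTo (𝟙 C)), φ ≠ 0 ∧
      value φ (U := V₀) h₀ e₀ = 1 ∧ value φ (U := U) hU t ≠ 0 :=
    ⟨_, he₀.toPushUnit_ne_zero (f := 𝟙 C) h₀, he₀.value_toPushUnit h₀,
      he₀.value_ne_zero_of_ne_zero h₀ hfr' hU ht⟩
  generalize htau : value φ (U := U) hU t = τ at hτ
  have hb (z : C) : ∃ b : C.functionField, b ≠ 0 ∧ IsBoundedAt φ z (Submodule.span _ {b}) ∧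
      Scheme.ord τ z - D z = Scheme.ord b z := by
    by_cases hz : z = genericPoint C
    · subst hz
      have hz' : Order.coheight (genericPoint C) ≠ 1 :=
        fun h => (coheight_eq_one_iff hdim _).mp h rfl
      have h1 := isBoundedAt_of_generator φ (z := genericPoint C) (V := V₀) h₀ he₀
      rw [hφ₀] at h1
      -- At the generic point the frame `e₀` has value `1`, and all orders are zero by convention.
      refine ⟨1, one_ne_zero, h1, ?_⟩
      rw [hD0 _ hz', Scheme.ord_eq_zero_of_coheight_neq_one hz', ord_one, sub_zero]
    · have h1 := hD z ((coheight_eq_one_iff hdim z).mpr hz)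
      obtain ⟨b, hb, hb', hord⟩ := h1.ord_value hU φ (by rwa [htau])
      rw [htau] at hord
      exact ⟨b, hb, hb', by linarith⟩
  choose b hb0 hb hord using hb
  obtain ⟨l, c, hl, hc, hfin⟩ := hL.exists_isBoundedAt (f := f) hdim
  refine finsum_nonneg_of_forall_exists p hdim hτ hfin (s₀ := s₀) fun s hs => ?_
  obtain ⟨a, ha, ha'⟩ := exists_value_ne_zero_of_isGloballyGenerated (quotientHom_ne_zero u hφ) hl
    (hgen s hs) (fun z => isBoundedAt_quotientHom u (hb z)) hc
  refine ⟨a, ha, fun z => ?_⟩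
  have hcz : c z ≠ 0 := by
    intro h
    have h1 := ha' z
    rw [h, mul_zero, Submodule.span_zero_singleton, Submodule.mem_bot] at h1
    exact ha h1
  have h1 := ord_le_of_mem_span hdim ha (ha' z)
  rw [Scheme.ord_mul (pow_ne_zero s (hb0 z)) hcz, ord_pow (hb0 z)] at h1
  rw [hord z]
  exact h1

end Degree

end NefBundle

end

theorem proposition4p1 {X : Scheme.{0}} (p : X ⟶ Spec (.of ℂ))
    (hX : NefBundle.IsNonsingularProjectiveVariety p) (L E : X.Modules)
    (hL : NefBundle.IsLineBundle L) (hE : NefBundle.IsVectorBundle E)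
    (hgen : ∃ s₀ : ℕ, ∀ s : ℕ, s₀ ≤ s →
      NefBundle.IsGloballyGenerated (NefBundle.tensor (NefBundle.tensorPow E s) L)) :
    NefBundle.IsNef p E := by
  obtain ⟨s₀, hgen⟩ := hgen
  intro P π Q q hq C _ _ i _ _ hdim d hd
  have := hq.epi
  -- The pullback of the universal quotient to the curve is again an epimorphism, since pullback is
  -- a left adjoint.
  exact NefBundle.nonneg_of_hasDegree (f := i ≫ π) (i ≫ π ≫ p) hdim hL hgen
    ((Scheme.Modules.pullbackComp i π).inv.app E ≫ (Scheme.Modules.pullback i).map q) hd
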